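/- Let $N\ge 3$ and let $\mathbb{Z}_N\times\mathbb{Z}$ be the cylinder graph, in which $(x,y)$ is adjacent to $(x\pm1,y)$ and $(x,y\pm1)$. Put $R_k=\{(x,y): y\le k\}$ and $\Omega=\{A\subseteq\mathbb{Z}_N\times\mathbb{Z}: A=R_0\cup F \text{ for some finite } F\}$. For $A\in\Omega$ let $h(A)=\max\{y:(x,y)\in A \text{ for some } x\}$, $|A|=\#\{(x,y)\in A: y>0\}$, and let $\mathcal{E}(A)=h(A)-|A|/N$ be the excess height of $A$. Let $k_A=\max\{k\ge 0: R_k\subseteq A\}$ and let $\mathcal{S}(A)=\{(x,y-k_A):(x,y)\in A\}$ be the downshift of $A$. Shifted IDLA is the Markov chain on $\Omega$ which moves from $A$ to $\mathcal{S}(A\cup\{Z\})$, where $Z$ is the exit location from $A$ (the first vertex visited outside $A$) of a simple random walk on the cylinder graph started from a uniformly chosen vertex of level $\{y=0\}$, independent of the past. For every $\eta\in(0,1)$ there is $N_0=N_0(\eta)$ such that for all $N\ge \max(N_0,3)$ the following holds. Shifted IDLA has exactly one stationary distribution $\mu_N$ on $\Omega$, and for every real number $$\mathcal{E}^*\ \ge\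 \Big\lceil 2\,n^* N\log\Big(\frac{N}{1-\eta}\Big)\Big\rceil ,\qquad n^*=20\,N\log N,$$ one has $$\mu_N\big(\{A\in\Omega:\ \mathcal{E}(A)>2\,\mathcal{E}^*\}\big)\ \le\ e^{-N/2}.$$ -/

import Mathlib

open scoped ENNReal

noncomputable section

namespace IDLA

/-- The vertices of the cylinder graph `ℤ_N × ℤ`; `p.1` is the horizontal coordinate and
`p.2` the vertical one. -/
abbrev Site (N : ℕ) : Type := ZMod N × ℤ

/-- The infinite rectangle `R_k = {(x, y) : y ≤ k}`. -/
def rect (N : ℕ) (k : ℤ) : Set (Site N) := {p | p.2 ≤ k}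

/-- The configuration space `Ω`: the sets `R_0 ∪ F` with `F` finite. -/
def Cluster (N : ℕ) : Type :=
  {A : Set (Site N) // ∃ F : Set (Site N), F.Finite ∧ A = rect N 0 ∪ F}

/-- The occupied sites of a cluster. -/
def Cluster.sites {N : ℕ} (A : Cluster N) : Set (Site N) := A.1

/-- `Ω` is a countable discrete space: every set of clusters is measurable. -/
instance (N : ℕ) : MeasurableSpace (Cluster N) := ⊤

/-- The flat configuration `R_0`. -/
def flat (N : ℕ) : Cluster N := ⟨rect N 0, ∅, Set.finite_empty, by simp⟩

/-- The cluster `A ∪ {z}`. -/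
def Cluster.add {N : ℕ} (A : Cluster N) (z : Site N) : Cluster N :=
  ⟨A.sites ∪ {z}, by
    obtain ⟨F, hF, hA⟩ := A.2
    refine ⟨F ∪ {z}, hF.union (Set.finite_singleton z), ?_⟩
    rw [← Set.union_assoc, ← hA]
    rfl⟩

/-- `|A|`: the number of occupied sites above level `0`. -/
def Cluster.size {N : ℕ} (A : Cluster N) : ℕ := {p ∈ A.sites | 0 < p.2}.ncard

/-- `h(A) = max {y : (x, y) ∈ A for some x}` (the set is nonempty and bounded above). -/
def Cluster.height {N : ℕ} (A : Cluster N) : ℤ := sSup {y : ℤ | ∃ x : ZMod N, (x, y) ∈ A.sites}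

/-- The excess height `𝓔(A) = h(A) - |A| / N`. -/
def Cluster.excess {N : ℕ} (A : Cluster N) : ℝ := (A.height : ℝ) - (A.size : ℝ) / (N : ℝ)

/-- `k_A = max {k ≥ 0 : R_k ⊆ A}` (the set contains `0` and is bounded above). -/
def Cluster.fill {N : ℕ} (A : Cluster N) : ℕ := sSup {k : ℕ | rect N k ⊆ A.sites}

theorem Cluster.rect_fill_subset {N : ℕ} (A : Cluster N) : rect N A.fill ⊆ A.sites := by
  have h0 : (0 : ℕ) ∈ {k : ℕ | rect N k ⊆ A.sites} := by
    obtain ⟨F, -, hA⟩ := A.2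
    intro p hp
    change p ∈ A.1
    rw [hA]
    exact Or.inl (by simpa using hp)
  have hb : BddAbove {k : ℕ | rect N k ⊆ A.sites} := by
    obtain ⟨F, hF, hA⟩ := A.2
    obtain ⟨M, hM⟩ := (hF.image Prod.snd).bddAbove
    refine ⟨M.toNat, fun k hk => ?_⟩
    have hmem : ((0 : ZMod N), (k : ℤ)) ∈ A.1 := hk (le_refl (k : ℤ))
    rw [hA] at hmem
    rcases hmem with h | h
    · have h' : (k : ℤ) ≤ 0 := h
      omega
    · have h' : (k : ℤ) ≤ M := hM ⟨_, h, rfl⟩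
      omega
  exact Nat.sSup_mem ⟨0, h0⟩ hb

/-- The downshift `𝓢(A) = {(x, y - k_A) : (x, y) ∈ A}`. -/
def Cluster.shift {N : ℕ} (A : Cluster N) : Cluster N :=
  ⟨(fun p : Site N => (p.1, p.2 - (A.fill : ℤ))) '' A.sites, by
    obtain ⟨F, hF, hA⟩ := A.2
    refine ⟨(fun p : Site N => (p.1, p.2 - (A.fill : ℤ))) '' F, hF.image _, ?_⟩
    apply Set.Subset.antisymm
    · rintro _ ⟨p, hp, rfl⟩
      have hp' : p ∈ rect N 0 ∪ F := hA ▸ hp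
      rcases hp' with h | h
      · left
        have h' : p.2 ≤ 0 := h
        change p.2 - (A.fill : ℤ) ≤ 0
        omega
      · exact Or.inr ⟨p, h, rfl⟩
    · rintro q (hq | ⟨p, hp, rfl⟩)
      · refine ⟨(q.1, q.2 + (A.fill : ℤ)), A.rect_fill_subset ?_, by simp⟩
        have hq' : q.2 ≤ 0 := hq
        change q.2 + (A.fill : ℤ) ≤ (A.fill : ℤ)
        omega
      · refine ⟨p, ?_, rfl⟩
        change p ∈ A.1
        rw [hA]
        exact Or.inr hp⟩

open Classical in
/-- `exitProb A n x z` is the probability that a simple random walk on the cylinder graph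
started at `x` visits the complement of `A` for the first time at time `n`, at the vertex `z`. -/
def exitProb {N : ℕ} (A : Set (Site N)) : ℕ → Site N → Site N → ℝ≥0∞
  | 0, x, z => if x ∉ A ∧ x = z then 1 else 0
  | n + 1, x, z =>
      if x ∈ A then
        (exitProb A n (x.1 + 1, x.2) z + exitProb A n (x.1 - 1, x.2) z
          + exitProb A n (x.1, x.2 + 1) z + exitProb A n (x.1, x.2 - 1) z) / 4
      else 0

/-- `P(Z = z)`, where `Z` is the exit location from `A` of a simple random walk started from a
uniform vertex of level `0`. -/
def settleProb {N : ℕ} [NeZero N] (A : Set (Site N)) (z : Site N) : ℝ≥0∞ :=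
  (∑ x : ZMod N, ∑' n : ℕ, exitProb A n (x, 0) z) / (N : ℝ≥0∞)

/-- The law of `A(1) = A ∪ {Z}` for the IDLA chain with `A(0) = A`. -/
def idlaStep {N : ℕ} [NeZero N] (A : Cluster N) : MeasureTheory.Measure (Cluster N) :=
  MeasureTheory.Measure.sum fun z : Site N =>
    settleProb A.sites z • MeasureTheory.Measure.dirac (A.add z)

/-- The transition kernel of Shifted IDLA: from `A`, add one particle by the IDLA rule and then
downshift. -/
def shiftedIDLA (N : ℕ) [NeZero N] : ProbabilityTheory.Kernel (Cluster N) (Cluster N) where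
  toFun A := (idlaStep A).map Cluster.shift
  measurable' := measurable_from_top

/-- `μ` is a stationary distribution of Shifted IDLA. -/
def IsStationary {N : ℕ} [NeZero N] (μ : MeasureTheory.Measure (Cluster N)) : Prop :=
  MeasureTheory.IsProbabilityMeasure μ ∧ ProbabilityTheory.Kernel.Invariant (shiftedIDLA N) μ

/-- `n* = 20 N log N`. -/
def nStar (N : ℕ) : ℝ := 20 * (N : ℝ) * Real.log N

/-- The least admissible value `⌈2 n* N log (N / (1 - η))⌉` of `𝓔*(N, η)`. -/
def excessThreshold (N : ℕ) (η : ℝ) : ℤ := ⌈2 * nStar N * (N : ℝ) * Real.log ((N : ℝ) / (1 - η))⌉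

end IDLA

end

/-! The excess height is the number of vacant sites at or below the top, divided by `N`
(`Cluster.excess_eq`). Downshifting preserves the vacancy count. A new particle either fills a
vacancy (count down by one) or settles on the row just above the top (count up by `N - 1`). So
everything reduces to bounding the probability `riseProb` of the second event.

To raise the height, the walk must climb past every level that is not full. At such a level some
site is vacant, and the Poisson kernel of the half cylinder is at least `1 / (2N)` once the start is
`mixDepth N`, about `2 N log N`, levels lower. Hence each block of `mixDepth N` non-full levels
costs a factor `1 - 1 / (2N)` (`exitIn_above_le`). Excess at least `T = 40 N² log² N` forces at
least `T` non-full levels, which gives `riseProb ≤ 1 / (4N)` (`Cluster.riseProb_le`).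

Two drift arguments finish the proof. A Lyapunov function of the vacancy count bounds the mean
return time to the flat cluster, which gives existence and uniqueness by regeneration
(`existsUnique_invariant`). The function `exp 𝓔` contracts by `exp (-1 / (2N))` in mean above `T`,
so its stationary mean is at most `4N exp (T + 1)`; Markov's inequality at `2 𝓔* ≥ 2T` then leaves
far less than `exp (-N / 2)`. -/

namespace IDLA

open MeasureTheory ProbabilityTheory Filter Topology

/-! ### Stationary laws from drift conditions. -/

section MarkovChain

variable {X : Type*} [MeasurableSpace X]

/-- The kernel `P` killed at the state `a`. -/
noncomputable def killed [MeasurableSingletonClass X] (P : Kernel X X) (a : X) : Kernel X X :=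
  haveI : DecidablePred (· ∈ ({a} : Set X)) := Classical.decPred _
  Kernel.piecewise (measurableSet_singleton a) 0 P

/-- The law of the chain started from `μ` after `n` steps of the kernel `K`. -/
noncomputable def iterLaw (K : Kernel X X) (μ : Measure X) : ℕ → Measure X
  | 0 => μ
  | n + 1 => (iterLaw K μ n).bind K

/-- The mass that `n` steps of the kernel `K` leave when started from a point. -/
noncomputable def survival (K : Kernel X X) : ℕ → X → ℝ≥0∞
  | 0, _ => 1
  | n + 1, x => ∫⁻ y, survival K n y ∂(K x)

variable (K : Kernel X X)

theorem measurable_survival (n : ℕ) : Measurable (survival K n) := by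
  induction n with
  | zero => exact measurable_const
  | succ n ih => exact ih.lintegral_kernel

theorem iterLaw_bind (μ : Measure X) (n : ℕ) :
    iterLaw K (μ.bind K) n = iterLaw K μ (n + 1) := by
  induction n with
  | zero => rfl
  | succ n ih => rw [iterLaw, ih]; rfl

theorem iterLaw_univ (μ : Measure X) (n : ℕ) :
    iterLaw K μ n Set.univ = ∫⁻ x, survival K n x ∂μ := by
  induction n generalizing μ with
  | zero => simp [iterLaw, survival]
  | succ n ih =>
    rw [← iterLaw_bind, ih,
      Measure.lintegral_bind K.aemeasurable (measurable_survival K n).aemeasurable]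
    rfl

theorem iterLaw_add (μ ν : Measure X) (n : ℕ) :
    iterLaw K (μ + ν) n = iterLaw K μ n + iterLaw K ν n := by
  induction n with
  | zero => rfl
  | succ n ih => rw [iterLaw, ih, Measure.comp_add]; rfl

theorem iterLaw_smul (c : ℝ≥0∞) (μ : Measure X) (n : ℕ) :
    iterLaw K (c • μ) n = c • iterLaw K μ n := by
  induction n with
  | zero => rfl
  | succ n ih => rw [iterLaw, ih, Measure.comp_smul]; rfl

/-- A geometric drift condition bounds the stationary mean of the Lyapunov function. -/
theorem lintegral_le_of_invariant {P : Kernel X X} {μ : Measure X} [IsProbabilityMeasure μ]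
    [IsMarkovKernel P] (hμ : Kernel.Invariant P μ) {V : X → ℝ≥0∞} (hV : Measurable V)
    (hfin : ∀ x, V x ≠ ∞) {c b : ℝ≥0∞} (hc : c ≤ 1)
    (hdrift : ∀ x, ∫⁻ y, V y ∂(P x) ≤ c * V x + b) : (1 - c) * ∫⁻ x, V x ∂μ ≤ b := by
  have hcfin : c ≠ ∞ := ne_top_of_le_ne_top ENNReal.one_ne_top hc
  have hcV : ∀ x, c * V x ≤ V x := fun x => mul_le_of_le_one_left' hc
  -- The mean of `V` might be infinite, so stationarity cannot be used by subtraction directly.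
  -- Truncating at `M` makes the subtraction legitimate; Fatou's lemma then removes `M`.
  have htr : ∀ M : ℕ, ∫⁻ x, (min (V x) M - min (c * V x) M) ∂μ ≤ b := by
    intro M
    have hm : ∫⁻ x, min (c * V x) M ∂μ ≠ ∞ := by
      refine ne_top_of_le_ne_top (b := ∫⁻ _, (M : ℝ≥0∞) ∂μ) (by simp)
        (lintegral_mono fun x => min_le_right _ _)
    rw [lintegral_sub ((hV.const_mul c).min measurable_const) hm
      (ae_of_all _ fun x => min_le_min_right _ (hcV x)), tsub_le_iff_left]
    have h1 : ∫⁻ x, min (V x) M ∂μ = ∫⁻ x, ∫⁻ y, min (V y) M ∂(P x) ∂μ := by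
      conv_lhs => rw [← hμ.def]
      exact Measure.lintegral_bind P.aemeasurable (hV.min measurable_const).aemeasurable
    have h2 : ∀ x, ∫⁻ y, min (V y) M ∂(P x) ≤ min (c * V x) M + b := by
      intro x
      have h3 : ∫⁻ y, min (V y) M ∂(P x) ≤ M :=
        (lintegral_mono fun y => min_le_right _ _).trans (by simp)
      have h4 : ∫⁻ y, min (V y) M ∂(P x) ≤ c * V x + b :=
        (lintegral_mono fun y => min_le_left _ _).trans (hdrift x)
      rcases le_total (c * V x) M with h | h
      · rwa [min_eq_left h]
      · rw [min_eq_right h]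
        exact h3.trans le_self_add
    rw [h1]
    refine (lintegral_mono h2).trans ?_
    rw [lintegral_add_right _ measurable_const]
    simp
  rw [← lintegral_const_mul _ hV]
  have hlim : ∀ x, (1 - c) * V x =
      liminf (fun M : ℕ => min (V x) M - min (c * V x) M) atTop := by
    intro x
    refine (Tendsto.liminf_eq (tendsto_const_nhds.congr' ?_)).symm
    obtain ⟨m, hm⟩ := ENNReal.exists_nat_gt (hfin x)
    filter_upwards [eventually_ge_atTop m] with M hM
    have h1 : V x ≤ M := hm.le.trans (by exact_mod_cast hM)
    rw [min_eq_left h1, min_eq_left ((hcV x).trans h1),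
      ENNReal.sub_mul fun _ _ => hfin x, one_mul]
  simp_rw [hlim]
  refine (lintegral_liminf_le fun M => ?_).trans ?_
  · exact (hV.min measurable_const).sub ((hV.const_mul c).min measurable_const)
  · exact liminf_le_of_le (by isBoundedDefault) fun d hd => by
      obtain ⟨M, hM⟩ := hd.exists
      exact hM.trans (htr M)

variable [MeasurableSingletonClass X] (P : Kernel X X) (a : X)

theorem killed_self : killed P a a = 0 := by
  simp [killed, Kernel.piecewise_apply]

theorem killed_of_ne {x : X} (hx : x ≠ a) : killed P a x = P x := by
  simp [killed, Kernel.piecewise_apply, hx]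

/-- Regeneration at the atom: mass sitting at `a` restarts from `P a`, and the rest moves under the
killed kernel. -/
theorem bind_eq_bind_killed_add (μ : Measure X) :
    μ.bind P = μ.bind (killed P a) + μ {a} • P a := by
  ext s hs
  rw [Measure.add_apply, Measure.bind_apply hs P.aemeasurable,
    Measure.bind_apply hs (killed P a).aemeasurable,
    ← lintegral_add_compl _ (measurableSet_singleton a),
    ← lintegral_add_compl (fun x => killed P a x s) (measurableSet_singleton a)]
  have h1 : ∫⁻ x in ({a} : Set X)ᶜ, killed P a x s ∂μ = ∫⁻ x in ({a} : Set X)ᶜ, P x s ∂μ := by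
    refine setLIntegral_congr_fun (measurableSet_singleton a).compl fun x hx => ?_
    simp only [killed_of_ne P a hx]
  rw [h1, lintegral_singleton, lintegral_singleton, killed_self]
  simp [mul_comm, add_comm]

/-- If `W` decreases by one in mean outside `a`, the expected time before the chain is killed
at `a` is at most `W`. -/
theorem sum_survival_le {W : X → ℝ≥0∞}
    (hdrift : ∀ x, x ≠ a → ∫⁻ y, W y ∂(P x) + 1 ≤ W x) [IsMarkovKernel P] (k : ℕ) (x : X) :
    ∑ n ∈ Finset.range k, survival (killed P a) (n + 1) x ≤ W x := by
  induction k generalizing x with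
  | zero => simp
  | succ k ih =>
    by_cases hx : x = a
    · subst hx
      simp [survival, killed_self]
    · refine le_trans ?_ (hdrift x hx)
      rw [Finset.sum_range_succ']
      have h1 : survival (killed P a) (0 + 1) x = 1 := by
        simp [survival, killed_of_ne P a hx]
      rw [h1]
      gcongr
      simp_rw [survival, killed_of_ne P a hx]
      rw [← lintegral_finsetSum _ fun n _ => ?_]
      · exact lintegral_mono fun y => ih y
      · exact measurable_survival (killed P a) (n + 1)

/-- A chain with an atom `a` whose mean return time is bounded by a drift condition has exactly
one stationary distribution. -/
theorem existsUnique_invariant [IsMarkovKernel P] {W : X → ℝ≥0∞} (hW : ∀ x, W x ≠ ∞)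
    (hWa : ∫⁻ y, W y ∂(P a) ≠ ∞)
    (hdrift : ∀ x, x ≠ a → ∫⁻ y, W y ∂(P x) + 1 ≤ W x) :
    ∃! μ : Measure X, IsProbabilityMeasure μ ∧ Kernel.Invariant P μ := by
  set K := killed P a with hK
  -- Expected occupation measure of one excursion from `a`, counting the return to `a` but not the
  -- departure. Its total mass is the mean return time.
  set ν : Measure X := Measure.sum fun n => iterLaw K (P a) n with hν
  have hsum : ∀ x, ∑' n, survival K (n + 1) x ≤ W x := fun x =>
    ENNReal.tsum_le_of_sum_range_le fun k => sum_survival_le P a hdrift k x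
  have hνuniv : ν Set.univ ≠ ∞ := by
    rw [hν, Measure.sum_apply _ MeasurableSet.univ]
    simp_rw [iterLaw_univ]
    rw [← lintegral_tsum fun n => (measurable_survival K n).aemeasurable]
    refine ne_top_of_le_ne_top (b := ∫⁻ x, (1 + W x) ∂(P a)) ?_ (lintegral_mono fun x => ?_)
    · rw [lintegral_add_left measurable_const]
      simpa using hWa
    · rw [tsum_eq_zero_add' ENNReal.summable]
      exact add_le_add le_rfl (hsum x)
  have hνK : ν = P a + ν.bind K := by
    rw [hν, Measure.bind_sum _ _ K.aemeasurable]
    ext s hs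
    rw [Measure.add_apply, Measure.sum_apply _ hs, Measure.sum_apply _ hs,
      tsum_eq_zero_add' ENNReal.summable]
    rfl
  have hmassK : ν.bind K Set.univ = ν {a}ᶜ := by
    rw [Measure.bind_apply MeasurableSet.univ K.aemeasurable,
      ← lintegral_add_compl _ (measurableSet_singleton a), lintegral_singleton, hK, killed_self,
      setLIntegral_congr_fun (g := fun _ => 1) (measurableSet_singleton a).compl fun x hx => by
        simp only [killed_of_ne P a hx, measure_univ]]
    simp
  -- Mass balance in `hνK`. Cancelling the mass outside `a` needs the mean return time to be finite.
  have hνa : ν {a} = 1 := by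
    have h1 : ν Set.univ = 1 + ν {a}ᶜ := by
      conv_lhs => rw [hνK]
      rw [Measure.add_apply, hmassK, measure_univ]
    rw [← measure_add_measure_compl (measurableSet_singleton a)] at h1
    exact (ENNReal.add_left_inj (ne_top_of_le_ne_top hνuniv (measure_mono (Set.subset_univ _)))).1
      h1
  have hνinv : ν.bind P = ν := by
    rw [bind_eq_bind_killed_add P a, hνa, one_smul, add_comm]
    exact hνK.symm
  have hν0 : ν Set.univ ≠ 0 := fun h => by
    have := measure_mono_null (Set.subset_univ {a}) h
    rw [hνa] at this
    exact one_ne_zero this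
  refine ⟨(ν Set.univ)⁻¹ • ν, ⟨⟨?_⟩, ?_⟩, ?_⟩
  · rw [Measure.smul_apply, smul_eq_mul, ENNReal.inv_mul_cancel hν0 hνuniv]
  · rw [Kernel.Invariant, Measure.comp_smul, hνinv]
  rintro μ ⟨hμ, hinv⟩
  have hstep : μ = μ.bind K + μ {a} • P a := by
    rw [← bind_eq_bind_killed_add P a]
    exact hinv.symm
  -- Unrolling stationarity over `n` steps, sorted by the last visit to `a`. The term that has not
  -- met `a` vanishes in the limit, so `μ` must be a multiple of `ν`.
  have hiter : ∀ n, μ = iterLaw K μ n + μ {a} • ∑ i ∈ Finset.range n, iterLaw K (P a) i := by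
    intro n
    induction n with
    | zero => simp [iterLaw]
    | succ n ih =>
      conv_lhs => rw [ih]
      have h2 : iterLaw K μ n = iterLaw K μ (n + 1) + μ {a} • iterLaw K (P a) n := by
        conv_lhs => rw [hstep, iterLaw_add, iterLaw_bind, iterLaw_smul]
      rw [h2, Finset.sum_range_succ, smul_add, add_assoc, add_comm (μ {a} • iterLaw K (P a) n)]
  have hlim : Tendsto (fun n => iterLaw K μ n Set.univ) atTop (𝓝 0) := by
    simp_rw [iterLaw_univ]
    have hle : ∀ n x, survival K n x ≤ 1 := by
      intro n
      induction n with
      | zero => intro x; exact le_rfl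
      | succ n ih =>
        intro x
        refine (lintegral_mono fun y => ih y).trans ?_
        by_cases hx : x = a
        · simp [hx, hK, killed_self]
        · simp [hK, killed_of_ne P a hx]
    have hp : ∀ x, Tendsto (fun n => survival K n x) atTop (𝓝 0) := fun x =>
      (tendsto_add_atTop_iff_nat 1).1 (ENNReal.tendsto_atTop_zero_of_tsum_ne_top
        (ne_top_of_le_ne_top (hW x) (hsum x)))
    simpa using tendsto_lintegral_of_dominated_convergence (fun _ => (1 : ℝ≥0∞))
      (fun n => measurable_survival K n) (fun n => ae_of_all μ (hle n)) (by simp)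
      (ae_of_all μ hp)
  have hμν : μ = μ {a} • ν := by
    ext s hs
    have h1 : Tendsto (fun n => iterLaw K μ n s +
        μ {a} * ∑ i ∈ Finset.range n, iterLaw K (P a) i s) atTop (𝓝 (0 + μ {a} * ν s)) := by
      refine Tendsto.add (tendsto_of_tendsto_of_tendsto_of_le_of_le tendsto_const_nhds hlim
        (fun n => zero_le) fun n => measure_mono (Set.subset_univ s)) ?_
      refine ENNReal.Tendsto.const_mul ?_ (Or.inr (measure_ne_top μ _))
      rw [hν, Measure.sum_apply _ hs]
      exact ENNReal.tendsto_nat_tsum _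
    have h2 : ∀ n, iterLaw K μ n s + μ {a} * ∑ i ∈ Finset.range n, iterLaw K (P a) i s = μ s := by
      intro n
      conv_rhs => rw [hiter n]
      simp
    simp_rw [h2] at h1
    simpa using tendsto_nhds_unique tendsto_const_nhds h1
  have hm : μ {a} = (ν Set.univ)⁻¹ := by
    have h1 : μ Set.univ = μ {a} * ν Set.univ := by
      conv_lhs => rw [hμν]
      rfl
    rw [measure_univ] at h1
    exact ENNReal.eq_inv_of_mul_eq_one_left h1.symm
  rw [← hm]
  exact hμν

end MarkovChain

end IDLA

/-! ### Bounded subharmonic functions on a half cylinder. -/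

namespace IDLA

section HalfCylinder

/-- A sequence on `ℤ` that is convex below `ℓ` and bounded above there is at most its value
at `ℓ`. -/
theorem le_of_convex_of_bounded {S : ℤ → ℝ} {ℓ : ℤ} {C : ℝ}
    (hconv : ∀ y < ℓ, 2 * S y ≤ S (y + 1) + S (y - 1)) (hbdd : ∀ y ≤ ℓ, S y ≤ C) {y : ℤ}
    (hy : y ≤ ℓ) : S y ≤ S ℓ := by
  have hmono : ∀ y < ℓ, S y ≤ S (y + 1) := by
    intro y hy
    by_contra! hlt
    set d := S y - S (y + 1) with hd
    have hdpos : 0 < d := by linarith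
    -- By convexity, a drop of `d` from `y` to `y + 1` persists at every lower level, so `S` would
    -- grow linearly towards `-∞`, against the bound `C`.
    have hback : ∀ k : ℕ, d ≤ S (y - k) - S (y - k + 1) ∧ S y + k * d ≤ S (y - k) := by
      intro k
      induction k with
      | zero => simp [hd]
      | succ k ih =>
        have h1 := hconv (y - k) (by omega)
        have e1 : y - ((k + 1 : ℕ) : ℤ) = y - k - 1 := by push_cast; ring
        have e2 : y - ((k + 1 : ℕ) : ℤ) + 1 = y - k := by push_cast; ring
        rw [e2, e1]
        push_cast
        constructor <;> linarith [ih.1, ih.2]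
    obtain ⟨k, hk⟩ := exists_nat_gt ((C - S y) / d)
    rw [div_lt_iff₀ hdpos] at hk
    linarith [(hback k).2, hbdd (y - k) (by omega)]
  have hall : ∀ k : ℕ, S (ℓ - k) ≤ S ℓ := by
    intro k
    induction k with
    | zero => simp
    | succ k ih =>
      have h := hmono (ℓ - k - 1) (by omega)
      have e1 : ℓ - ((k + 1 : ℕ) : ℤ) = ℓ - k - 1 := by push_cast; ring
      rw [e1]
      rw [sub_add_cancel] at h
      linarith
  have h := hall (ℓ - y).toNat
  rwa [Int.toNat_of_nonneg (by omega), sub_sub_cancel] at h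

variable {N : ℕ} [NeZero N]

/-- The sum of `w` over the four neighbours of a vertex of the cylinder. -/
def nbrSum {N : ℕ} {M : Type*} [Add M] (w : Site N → M) (p : Site N) : M :=
  w (p.1 + 1, p.2) + w (p.1 - 1, p.2) + w (p.1, p.2 + 1) + w (p.1, p.2 - 1)

/-- The maximum principle for bounded subharmonic functions on a half cylinder. -/
theorem le_of_subharmonic {w : Site N → ℝ} {ℓ : ℤ} {c C : ℝ}
    (hsub : ∀ p : Site N, p.2 < ℓ → 4 * w p ≤ nbrSum w p) (hbdd : ∀ p : Site N, p.2 ≤ ℓ → w p ≤ C)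
    (htop : ∀ x, w (x, ℓ) ≤ c) {p : Site N} (hp : p.2 ≤ ℓ) : w p ≤ c := by
  set S : ℤ → ℝ := fun y => Finset.univ.sup' Finset.univ_nonempty fun x : ZMod N => w (x, y)
  have hle : ∀ x y, w (x, y) ≤ S y := fun x y =>
    Finset.le_sup' (fun x : ZMod N => w (x, y)) (Finset.mem_univ x)
  have hS : S p.2 ≤ S ℓ := by
    refine le_of_convex_of_bounded (C := C) (fun y hy => ?_) (fun y hy => ?_) hp
    · obtain ⟨x, -, hx⟩ := Finset.exists_mem_eq_sup' (Finset.univ_nonempty (α := ZMod N))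
        fun x : ZMod N => w (x, y)
      have hx' : S y = w (x, y) := hx
      have h := hsub (x, y) hy
      unfold nbrSum at h
      linarith [hle (x + 1) y, hle (x - 1) y, hle x (y + 1), hle x (y - 1)]
    · exact Finset.sup'_le _ _ fun x _ => hbdd (x, y) hy
  exact (hle p.1 p.2).trans (hS.trans (Finset.sup'_le _ _ fun x _ => htop x))

/-! ### The Poisson kernel by Fourier series. -/

/-- The square root of `(1 - Re ψ(k)) / 2`, where `ψ` is the standard character of `ZMod N`. -/
noncomputable def freq (k : ZMod N) : ℝ := √((1 - (ZMod.stdAddChar k : ℂ).re) / 2)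

/-- The decay rate of the `k`-th Fourier mode of bounded harmonic functions on a half cylinder. -/
noncomputable def decay (k : ZMod N) : ℝ := (√(1 + freq k ^ 2) + freq k) ^ 2

theorem stdAddChar_re_eq (k : ZMod N) :
    (ZMod.stdAddChar k : ℂ).re = Real.cos (2 * Real.pi * k.val / N) := by
  have h := ZMod.stdAddChar_coe (N := N) k.val
  have e : ((k.val : ℤ) : ZMod N) = k := by simp
  rw [e] at h
  rw [h]
  have e2 : (2 * Real.pi * Complex.I * ((k.val : ℤ) : ℂ) / N : ℂ) =
      ((2 * Real.pi * k.val / N : ℝ) : ℂ) * Complex.I := by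
    push_cast
    ring
  rw [e2, Complex.exp_ofReal_mul_I_re]

theorem freq_eq (k : ZMod N) : freq k = |Real.sin (Real.pi * k.val / N)| := by
  have h : (1 - Real.cos (2 * Real.pi * k.val / N)) / 2 = Real.sin (Real.pi * k.val / N) ^ 2 := by
    have e : 2 * Real.pi * k.val / N = 2 * (Real.pi * k.val / N) := by ring
    rw [e, Real.cos_two_mul, Real.sin_sq]
    ring
  rw [freq, stdAddChar_re_eq, h, Real.sqrt_sq_eq_abs]

theorem freq_nonneg (k : ZMod N) : 0 ≤ freq k := Real.sqrt_nonneg _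

theorem freq_zero : freq (0 : ZMod N) = 0 := by simp [freq]

theorem freq_sq (k : ZMod N) : 4 * freq k ^ 2 = 2 - 2 * (ZMod.stdAddChar k : ℂ).re := by
  have h : (ZMod.stdAddChar k : ℂ).re ≤ 1 := by
    rw [stdAddChar_re_eq]
    exact Real.cos_le_one _
  rw [freq, Real.sq_sqrt (by linarith)]
  ring

/-- Spectral gap: Jordan's inequality `sin x ≥ 2x / π` for modes up to `N / 2`, and the reflection
`x ↦ π - x` for the others. -/
theorem two_div_le_freq {k : ZMod N} (hk : k ≠ 0) : 2 / (N : ℝ) ≤ freq k := by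
  have hN : (0 : ℝ) < N := by exact_mod_cast Nat.pos_of_ne_zero (NeZero.ne N)
  have hlt : k.val + 1 ≤ N := k.val_lt
  have hpos : 1 ≤ k.val := Nat.one_le_iff_ne_zero.2 ((ZMod.val_ne_zero k).2 hk)
  have hlt' : (k.val : ℝ) + 1 ≤ N := by exact_mod_cast hlt
  have hpos' : (1 : ℝ) ≤ k.val := by exact_mod_cast hpos
  have hpi := Real.pi_pos
  rw [freq_eq]
  refine le_trans ?_ (le_abs_self _)
  have key : ∀ j : ℝ, 1 ≤ j → j ≤ N / 2 → 2 / (N : ℝ) ≤ Real.sin (Real.pi * j / N) := by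
    intro j h1 h2
    have h := Real.mul_le_sin (x := Real.pi * j / N) (by positivity) (by
      rw [div_le_iff₀ hN]
      nlinarith)
    refine le_trans ?_ h
    have e : 2 / Real.pi * (Real.pi * j / N) = 2 * j / N := by field_simp
    rw [e]
    gcongr
    linarith
  rcases le_total (k.val : ℝ) (N / 2) with h | h
  · exact key _ hpos' h
  · have h2 := key (N - k.val) (by linarith) (by linarith)
    have e : Real.pi * (N - k.val) / N = Real.pi - Real.pi * k.val / N := by field_simp
    rwa [e, Real.sin_pi_sub] at h2

theorem decay_pos (k : ZMod N) : 0 < decay k := by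
  have h1 := freq_nonneg k
  have h2 : 0 < √(1 + freq k ^ 2) := Real.sqrt_pos.2 (by positivity)
  unfold decay
  positivity

theorem decay_zero : decay (0 : ZMod N) = 1 := by simp [decay, freq_zero]

/-- The separation-of-variables equation: it makes each mode `Re ψ(k x) * decay k ^ y` discrete
harmonic. -/
theorem decay_add_inv (k : ZMod N) :
    decay k + (decay k)⁻¹ = 4 - 2 * (ZMod.stdAddChar k : ℂ).re := by
  have hs : √(1 + freq k ^ 2) ^ 2 = 1 + freq k ^ 2 := Real.sq_sqrt (by positivity)
  have hinv : (decay k)⁻¹ = (√(1 + freq k ^ 2) - freq k) ^ 2 := by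
    refine inv_eq_of_mul_eq_one_right ?_
    rw [decay, ← mul_pow]
    have : (√(1 + freq k ^ 2) + freq k) * (√(1 + freq k ^ 2) - freq k) = 1 := by
      ring_nf
      rw [hs]
      ring
    rw [this, one_pow]
  rw [hinv, decay]
  have h := freq_sq k
  linear_combination 2 * hs + h

theorem one_add_two_mul_freq_le_decay (k : ZMod N) : 1 + 2 * freq k ≤ decay k := by
  have h1 := freq_nonneg k
  have h2 : 1 ≤ √(1 + freq k ^ 2) := Real.one_le_sqrt.2 (by nlinarith)
  unfold decay
  nlinarith

theorem one_le_decay (k : ZMod N) : 1 ≤ decay k := by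
  linarith [one_add_two_mul_freq_le_decay k, freq_nonneg k]

/-- The Poisson kernel of the half cylinder `{y ≤ 0}` with pole at `(0, 0)`. -/
noncomputable def poisson (p : Site N) : ℝ :=
  (∑ k : ZMod N, (ZMod.stdAddChar (k * p.1) : ℂ).re * decay k ^ p.2) / N

theorem poisson_harmonic (p : Site N) : nbrSum poisson p = 4 * poisson p := by
  unfold nbrSum poisson
  rw [← add_div, ← add_div, ← add_div, mul_div_assoc', ← Finset.sum_add_distrib,
    ← Finset.sum_add_distrib, ← Finset.sum_add_distrib, Finset.mul_sum]
  congr 1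
  refine Finset.sum_congr rfl fun k _ => ?_
  have h1 : (ZMod.stdAddChar (k * (p.1 + 1)) : ℂ).re + (ZMod.stdAddChar (k * (p.1 - 1)) : ℂ).re =
      2 * (ZMod.stdAddChar k : ℂ).re * (ZMod.stdAddChar (k * p.1) : ℂ).re := by
    have hinv : (ZMod.stdAddChar (-k) : ℂ) = (starRingEnd ℂ) (ZMod.stdAddChar k) := by
      rw [ZMod.stdAddChar_apply, ZMod.stdAddChar_apply, AddChar.map_neg_eq_inv,
        Circle.coe_inv_eq_conj]
    have e1 : k * (p.1 + 1) = k * p.1 + k := by ring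
    have e2 : k * (p.1 - 1) = k * p.1 + -k := by ring
    rw [e1, e2, AddChar.map_add_eq_mul, AddChar.map_add_eq_mul, hinv]
    simp only [Complex.mul_re, Complex.conj_re, Complex.conj_im]
    ring
  have h0 := (decay_pos k).ne'
  rw [zpow_add_one₀ h0, zpow_sub_one₀ h0]
  linear_combination (decay k ^ p.2) * h1 +
    (ZMod.stdAddChar (k * p.1) : ℂ).re * (decay k ^ p.2) * decay_add_inv k

theorem poisson_zero (x : ZMod N) : poisson (x, 0) = if x = 0 then 1 else 0 := by
  have hN : (N : ℝ) ≠ 0 := by exact_mod_cast NeZero.ne N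
  have h := AddChar.sum_mulShift x (ZMod.isPrimitive_stdAddChar N)
  have h2 := congrArg Complex.re h
  rw [Complex.re_sum] at h2
  simp only [poisson, zpow_zero, mul_one]
  rw [h2]
  split_ifs <;> simp [hN]

theorem abs_stdAddChar_re_le (k : ZMod N) : |(ZMod.stdAddChar k : ℂ).re| ≤ 1 := by
  rw [stdAddChar_re_eq]
  exact Real.abs_cos_le_one _

theorem abs_poisson_le {p : Site N} (hp : p.2 ≤ 0) : |poisson p| ≤ 1 := by
  have hN : (0 : ℝ) < N := by exact_mod_cast Nat.pos_of_ne_zero (NeZero.ne N)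
  rw [poisson, abs_div, abs_of_pos hN, div_le_one hN]
  refine (Finset.abs_sum_le_sum_abs _ _).trans ?_
  have : ∀ k ∈ (Finset.univ : Finset (ZMod N)),
      |(ZMod.stdAddChar (k * p.1) : ℂ).re * decay k ^ p.2| ≤ 1 := by
    intro k _
    rw [abs_mul, abs_of_pos (zpow_pos (decay_pos k) _)]
    exact mul_le_one₀ (abs_stdAddChar_re_le _) (zpow_pos (decay_pos k) _).le
      (zpow_le_one_of_nonpos₀ (one_le_decay k) hp)
  refine (Finset.sum_le_sum this).trans ?_
  simp [ZMod.card]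

/-- The depth `⌈2 N log N⌉` below which the Poisson kernel is close to uniform. -/
noncomputable def mixDepth (N : ℕ) : ℕ := ⌈2 * (N : ℝ) * Real.log N⌉₊

theorem decay_zpow_le (hN : 2 ≤ N) {k : ZMod N} (hk : k ≠ 0) {y : ℤ} (hy : y ≤ -mixDepth N) :
    decay k ^ y ≤ 1 / (2 * N) := by
  have hN' : (2 : ℝ) ≤ N := by exact_mod_cast hN
  have hN0 : (0 : ℝ) < N := by linarith
  have h1 : 1 + 4 / (N : ℝ) ≤ decay k := by
    have h2 : 4 / (N : ℝ) = 2 * (2 / N) := by ring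
    linarith [one_add_two_mul_freq_le_decay k, two_div_le_freq hk]
  -- With this rate, depth `2 N log N` gains a factor `N² ≥ 2N`.
  have h2 : Real.exp (1 / N) ≤ decay k := by
    refine le_trans ?_ h1
    rw [← Real.le_log_iff_exp_le (by positivity)]
    refine le_trans ?_ (Real.one_sub_inv_le_log_of_pos (by positivity))
    have e : 1 - (1 + 4 / (N : ℝ))⁻¹ = 4 / (N + 4) := by field_simp; ring
    rw [e, div_le_div_iff₀ hN0 (by positivity)]
    linarith
  have h3 : decay k ^ y ≤ decay k ^ (-(mixDepth N : ℤ)) := zpow_le_zpow_right₀ (one_le_decay k) hy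
  refine h3.trans ?_
  rw [zpow_neg, zpow_natCast, one_div]
  refine inv_anti₀ (by positivity) ?_
  refine le_trans ?_ (pow_le_pow_left₀ (Real.exp_pos _).le h2 _)
  rw [← Real.exp_nat_mul]
  have h4 : 2 * Real.log N ≤ mixDepth N * (1 / N) := by
    rw [mul_one_div, le_div_iff₀ hN0]
    have := Nat.le_ceil (2 * (N : ℝ) * Real.log N)
    unfold mixDepth
    linarith
  calc (2 * N : ℝ) ≤ N * N := by nlinarith
    _ = Real.exp (2 * Real.log N) := by rw [two_mul, Real.exp_add, Real.exp_log hN0]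
    _ ≤ _ := Real.exp_le_exp.2 h4

/-- The constant mode contributes `1 / N`. The other `N - 1` modes, each at most `1 / (2N)` before
normalisation, can cancel less than half of it. -/
theorem le_poisson (hN : 2 ≤ N) {p : Site N} (hp : p.2 ≤ -mixDepth N) :
    1 / (2 * N) ≤ poisson p := by
  have hN0 : (0 : ℝ) < N := by exact_mod_cast (by omega : 0 < N)
  rw [poisson, ← Finset.add_sum_erase _ _ (Finset.mem_univ (0 : ZMod N)), le_div_iff₀ hN0]
  have h1 : ∀ k ∈ Finset.univ.erase (0 : ZMod N),
      -(1 / (2 * N) : ℝ) ≤ (ZMod.stdAddChar (k * p.1) : ℂ).re * decay k ^ p.2 := by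
    intro k hk
    have h2 := decay_zpow_le hN (Finset.ne_of_mem_erase hk) hp
    have h3 := zpow_pos (decay_pos k) p.2
    have h4 := (abs_le.1 (abs_stdAddChar_re_le (k * p.1))).1
    nlinarith
  have h5 := Finset.sum_le_sum h1
  rw [Finset.sum_const, Finset.card_erase_of_mem (Finset.mem_univ _), Finset.card_univ, ZMod.card,
    nsmul_eq_mul, Nat.cast_sub (by omega)] at h5
  simp only [zero_mul, AddChar.map_zero_eq_one, Complex.one_re, decay_zero, one_zpow, mul_one]
  have e1 : 1 / (2 * N) * (N : ℝ) = 1 / 2 := by field_simp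
  have e2 : ((N : ℝ) - (1 : ℕ)) * -(1 / (2 * N)) = -(1 / 2) + 1 / (2 * N) := by
    push_cast
    field_simp
    ring
  have : (0 : ℝ) < 1 / (2 * N) := by positivity
  linarith

/-- A bounded subharmonic function with a zero at level `ℓ` is smaller by a definite factor far
below this level. -/
theorem le_mul_of_zero (hN : 2 ≤ N) {u : Site N → ℝ} {ℓ : ℤ} {m C : ℝ} {x₀ : ZMod N} (hm : 0 ≤ m)
    (hsub : ∀ p : Site N, p.2 < ℓ → 4 * u p ≤ nbrSum u p) (hbdd : ∀ p : Site N, p.2 ≤ ℓ → u p ≤ C)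
    (htop : ∀ x, u (x, ℓ) ≤ m) (hzero : u (x₀, ℓ) = 0) {p : Site N}
    (hp : p.2 + mixDepth N ≤ ℓ) : u p ≤ (1 - 1 / (2 * N)) * m := by
  -- Comparison with the harmonic function that is `m` on level `ℓ` except for the value `0` at
  -- `x₀`.
  set w : Site N → ℝ := fun q => u q - m * (1 - poisson (q.1 - x₀, q.2 - ℓ))
  have hw : w p ≤ 0 := by
    refine le_of_subharmonic (ℓ := ℓ) (C := C + m) (fun q hq => ?_) (fun q hq => ?_) (fun x => ?_)
      (show p.2 ≤ ℓ by omega)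
    · have h1 := hsub q hq
      have h2 := poisson_harmonic (q.1 - x₀, q.2 - ℓ)
      simp only [nbrSum, w] at h1 h2 ⊢
      have e1 : q.1 + 1 - x₀ = q.1 - x₀ + 1 := by ring
      have e2 : q.1 - 1 - x₀ = q.1 - x₀ - 1 := by ring
      have e3 : q.2 + 1 - ℓ = q.2 - ℓ + 1 := by ring
      have e4 : q.2 - 1 - ℓ = q.2 - ℓ - 1 := by ring
      rw [e1, e2, e3, e4]
      linear_combination h1 - m * h2
    · have h1 := (abs_le.1 (abs_poisson_le (p := (q.1 - x₀, q.2 - ℓ)) (by simpa using hq))).2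
      have h2 := hbdd q hq
      simp only [w]
      nlinarith
    · simp only [w, sub_self, poisson_zero, sub_eq_zero]
      split_ifs with h
      · rw [h, hzero]
        simp
      · linarith [htop x]
  have h1 := le_poisson hN (p := (p.1 - x₀, p.2 - ℓ)) (by simp only; omega)
  simp only [w] at hw
  nlinarith

end HalfCylinder

end IDLA

/-! ### Exit probabilities of the walk. -/

namespace IDLA

section Walk

variable {N : ℕ}

theorem exitProb_of_mem {A : Set (Site N)} {z : Site N} (hz : z ∈ A) (n : ℕ) (x : Site N) :
    exitProb A n x z = 0 := by
  induction n generalizing x with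
  | zero =>
    rw [exitProb, if_neg]
    rintro ⟨h1, rfl⟩
    exact h1 hz
  | succ n ih => simp [exitProb, ih]

/-- The walk leaves a cluster of height at most `h` at height at most `h + 1`. -/
theorem exitProb_of_lt {A : Set (Site N)} {h : ℤ} (hA : ∀ p ∈ A, p.2 ≤ h) {z : Site N}
    (hz : h + 1 < z.2) (n : ℕ) {x : Site N} (hx : x.2 ≤ h + 1) : exitProb A n x z = 0 := by
  induction n generalizing x with
  | zero =>
    rw [exitProb, if_neg]
    rintro ⟨-, rfl⟩
    omega
  | succ n ih =>
    rw [exitProb]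
    split_ifs with hxA
    · have := hA x hxA
      rw [ih (by simp only; omega), ih (by simp only; omega), ih (by simp only; omega),
        ih (by simp only; omega)]
      simp
    · rfl

/-- The Green function: the probability that the walk started at `x` leaves `A` at `z`. -/
noncomputable def exitLaw (A : Set (Site N)) (x z : Site N) : ℝ≥0∞ := ∑' n, exitProb A n x z

theorem exitLaw_of_notMem {A : Set (Site N)} {x : Site N} (hx : x ∉ A) [DecidableEq (Site N)]
    (z : Site N) : exitLaw A x z = if x = z then 1 else 0 := by
  rw [exitLaw, tsum_eq_zero_add' ENNReal.summable]
  simp [exitProb, hx]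

theorem exitLaw_of_mem {A : Set (Site N)} {x : Site N} (hx : x ∈ A) (z : Site N) :
    exitLaw A x z = nbrSum (fun y => exitLaw A y z) x / 4 := by
  rw [exitLaw, tsum_eq_zero_add' ENNReal.summable]
  simp only [exitProb, hx, not_true, false_and, if_false, if_true, zero_add, div_eq_mul_inv,
    ENNReal.tsum_mul_right]
  simp only [nbrSum, exitLaw]
  rw [ENNReal.tsum_add, ENNReal.tsum_add, ENNReal.tsum_add]

/-- The probability that the walk started at `x` leaves `A` at a vertex of `B`. -/
noncomputable def exitIn (A B : Set (Site N)) (x : Site N) : ℝ≥0∞ := ∑' z : B, exitLaw A x z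

theorem exitIn_of_mem {A : Set (Site N)} (B : Set (Site N)) {x : Site N} (hx : x ∈ A) :
    exitIn A B x = nbrSum (exitIn A B) x / 4 := by
  simp only [exitIn, exitLaw_of_mem hx, nbrSum, div_eq_mul_inv, ENNReal.tsum_mul_right]
  rw [ENNReal.tsum_add, ENNReal.tsum_add, ENNReal.tsum_add]

open Classical in
theorem exitIn_of_notMem {A : Set (Site N)} (B : Set (Site N)) {x : Site N} (hx : x ∉ A) :
    exitIn A B x = if x ∈ B then 1 else 0 := by
  simp only [exitIn, exitLaw_of_notMem hx]
  split_ifs with h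
  · rw [tsum_eq_single (⟨x, h⟩ : B)]
    · simp
    · intro z hz
      rw [if_neg]
      rintro rfl
      exact hz rfl
  · rw [ENNReal.tsum_eq_zero]
    rintro ⟨z, hz⟩
    rw [if_neg]
    rintro rfl
    exact h hz

/-- Exits at different times are disjoint events; the induction bounds the probability of exit
before each time `m`. -/
theorem exitIn_univ_le_one (A : Set (Site N)) (x : Site N) : exitIn A Set.univ x ≤ 1 := by
  classical
  have hfin : ∀ (m : ℕ) (x : Site N), ∑ n ∈ Finset.range m, ∑' z, exitProb A n x z ≤ 1 := by
    intro m
    induction m with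
    | zero => simp
    | succ m ih =>
      intro x
      rw [Finset.sum_range_succ']
      by_cases hx : x ∈ A
      · simp only [exitProb, hx, not_true, false_and, if_false, if_true, tsum_zero, add_zero,
          div_eq_mul_inv, ENNReal.tsum_mul_right, ENNReal.tsum_add, ← Finset.sum_mul,
          Finset.sum_add_distrib]
        rw [← div_eq_mul_inv]
        refine ENNReal.div_le_of_le_mul ?_
        have h4 : (1 : ℝ≥0∞) * 4 = 1 + 1 + 1 + 1 := by norm_num
        rw [h4]
        exact add_le_add (add_le_add (add_le_add (ih _) (ih _)) (ih _)) (ih _)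
      · simp [exitProb, hx]
  rw [exitIn, tsum_univ (fun z => exitLaw A x z)]
  simp only [exitLaw]
  rw [ENNReal.tsum_comm]
  exact ENNReal.tsum_le_of_sum_range_le fun m => hfin m x

theorem exitIn_le_one (A B : Set (Site N)) (x : Site N) : exitIn A B x ≤ 1 :=
  (ENNReal.tsum_mono_subtype (fun z => exitLaw A x z) (Set.subset_univ B)).trans
    (exitIn_univ_le_one A x)

theorem exitIn_ne_top (A B : Set (Site N)) (x : Site N) : exitIn A B x ≠ ∞ :=
  ne_top_of_le_ne_top ENNReal.one_ne_top (exitIn_le_one A B x)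

theorem exitIn_toReal_le_one (A B : Set (Site N)) (x : Site N) : (exitIn A B x).toReal ≤ 1 :=
  ENNReal.toReal_le_of_le_ofReal zero_le_one (by simpa using exitIn_le_one A B x)

theorem exitIn_toReal_of_mem {A : Set (Site N)} (B : Set (Site N)) {x : Site N} (hx : x ∈ A) :
    4 * (exitIn A B x).toReal = nbrSum (fun y => (exitIn A B y).toReal) x := by
  rw [exitIn_of_mem B hx]
  have h := exitIn_ne_top A B
  simp only [nbrSum, ENNReal.toReal_div]
  rw [ENNReal.toReal_add (by simp [h]) (h _), ENNReal.toReal_add (by simp [h]) (h _),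
    ENNReal.toReal_add (h _) (h _)]
  simp
  ring

/-- The vertices above level `h`. -/
def above (N : ℕ) (h : ℤ) : Set (Site N) := {p | h < p.2}

/-- The levels in `(y, h]` that `A` does not fill. -/
def vacantLevels (A : Set (Site N)) (y h : ℤ) : Set ℤ := {ℓ | y < ℓ ∧ ℓ ≤ h ∧ ∃ x, (x, ℓ) ∉ A}

theorem vacantLevels_finite (A : Set (Site N)) (y h : ℤ) : (vacantLevels A y h).Finite :=
  (Set.finite_Ioc y h).subset fun _ hl => ⟨hl.1, hl.2.1⟩

/-- Harmonic on `A`; at a vacant site up to level `h` the walk has already stopped, the value is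
`0`, and subharmonicity is trivial. -/
theorem exitIn_above_subharmonic (A : Set (Site N)) {h : ℤ} {p : Site N} (hp : p.2 ≤ h) :
    4 * (exitIn A (above N h) p).toReal ≤ nbrSum (fun y => (exitIn A (above N h) y).toReal) p := by
  by_cases hpA : p ∈ A
  · exact (exitIn_toReal_of_mem _ hpA).le
  · have h0 : p ∉ above N h := not_lt.2 hp
    rw [exitIn_of_notMem _ hpA, if_neg h0]
    simp only [nbrSum, ENNReal.toReal_zero, mul_zero]
    positivity

variable [NeZero N]

/-- The walk leaves a cluster of bounded height almost surely. -/
theorem exitIn_univ_eq_one {A : Set (Site N)} {h : ℤ} (hA : ∀ p ∈ A, p.2 ≤ h) {x : Site N}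
    (hx : x.2 ≤ h + 1) : exitIn A Set.univ x = 1 := by
  have hout : ∀ y ∉ A, exitIn A Set.univ y = 1 := fun y hy => by
    simp [exitIn_of_notMem Set.univ hy]
  have hle : 1 - (exitIn A Set.univ x).toReal ≤ 0 := by
    -- The probability of never leaving `A` is bounded, subharmonic below level `h + 1` and zero on
    -- it, so the maximum principle kills it.
    refine le_of_subharmonic (w := fun y => 1 - (exitIn A Set.univ y).toReal) (ℓ := h + 1) (C := 1)
      (fun p _ => ?_) (fun p _ => ?_) (fun y => ?_) hx
    · by_cases hp : p ∈ A
      · have := exitIn_toReal_of_mem Set.univ hp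
        simp only [nbrSum] at this ⊢
        linarith
      · have := exitIn_toReal_le_one A Set.univ
        simp only [nbrSum, hout p hp, ENNReal.toReal_one]
        linarith [this (p.1 + 1, p.2), this (p.1 - 1, p.2), this (p.1, p.2 + 1),
          this (p.1, p.2 - 1)]
    · simp
    · rw [hout _ fun hy => by have := hA _ hy; simp only at this; omega]
      simp
  have h1 : (exitIn A Set.univ x).toReal = 1 :=
    le_antisymm (exitIn_toReal_le_one _ _ _) (by linarith)
  rw [← ENNReal.ofReal_toReal (exitIn_ne_top A Set.univ x), h1, ENNReal.ofReal_one]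

/-- The probability of climbing over `J * mixDepth N` levels that are not full is at most
`(1 - 1 / (2 N)) ^ J`. -/
theorem exitIn_above_le (hN : 2 ≤ N) (A : Set (Site N)) {h : ℤ} (J : ℕ) {p : Site N}
    (hp : p.2 ≤ h) (hJ : J * mixDepth N ≤ (vacantLevels A p.2 h).ncard) :
    (exitIn A (above N h) p).toReal ≤ (1 - 1 / (2 * N)) ^ J := by
  have hN0 : (2 : ℝ) ≤ N := by exact_mod_cast hN
  have hρ : (0 : ℝ) ≤ 1 - 1 / (2 * N) := by
    rw [sub_nonneg, div_le_one (by linarith)]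
    linarith
  have hD : 1 ≤ mixDepth N := by
    rw [mixDepth, Nat.one_le_ceil_iff]
    have := Real.log_pos (by linarith : (1 : ℝ) < N)
    positivity
  induction J generalizing p with
  | zero => simpa using exitIn_toReal_le_one _ _ _
  | succ J ih =>
    have hfin := vacantLevels_finite A (p.2 + mixDepth N - 1) h
    -- Discarding the `mixDepth N - 1` levels just above `p` puts the next non-full level deep
    -- enough above `p` for the Poisson bound. The extra `1` pays for that level itself.
    have hcard : J * mixDepth N + 1 ≤ (vacantLevels A (p.2 + mixDepth N - 1) h).ncard := by
      have h1 : vacantLevels A p.2 h ⊆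
          Set.Ioc p.2 (p.2 + mixDepth N - 1) ∪ vacantLevels A (p.2 + mixDepth N - 1) h := by
        rintro l ⟨h1, h2, h3⟩
        by_cases hl : l ≤ p.2 + mixDepth N - 1
        · exact Or.inl ⟨h1, hl⟩
        · exact Or.inr ⟨not_le.1 hl, h2, h3⟩
      have h2 := (Set.ncard_le_ncard h1 ((Set.finite_Ioc _ _).union hfin)).trans
        (Set.ncard_union_le _ _)
      have h3 : (Set.Ioc p.2 (p.2 + mixDepth N - 1)).ncard = mixDepth N - 1 := by
        rw [← Finset.coe_Ioc, Set.ncard_coe_finset, Int.card_Ioc]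
        omega
      rw [h3] at h2
      rw [add_mul] at hJ
      omega
    obtain ⟨ℓ, hℓ, hmin⟩ := hfin.exists_minimal
      (Set.nonempty_of_ncard_ne_zero (by omega))
    obtain ⟨hℓ1, hℓ2, x₀, hx₀⟩ := hℓ
    have hrest : J * mixDepth N ≤ (vacantLevels A ℓ h).ncard := by
      have h1 : vacantLevels A (p.2 + mixDepth N - 1) h ⊆ insert ℓ (vacantLevels A ℓ h) := by
        intro l hl
        rcases lt_trichotomy l ℓ with h | h | h
        · exact absurd (hmin hl h.le) (not_le.2 h)
        · exact Or.inl h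
        · exact Or.inr ⟨h, hl.2⟩
      have h2 := (Set.ncard_le_ncard h1 ((vacantLevels_finite A ℓ h).insert _)).trans
        (Set.ncard_insert_le _ _)
      omega
    rw [pow_succ']
    -- The induction hypothesis bounds the whole level `ℓ`, and the vacant site on it supplies the
    -- zero.
    refine le_mul_of_zero (u := fun q => (exitIn A (above N h) q).toReal) (ℓ := ℓ) (C := 1)
      (x₀ := x₀) hN (pow_nonneg hρ J) (fun q hq => exitIn_above_subharmonic A (by omega))
      (fun q _ => exitIn_toReal_le_one _ _ _) (fun x => ih hℓ2 hrest) ?_ (by omega)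
    have hbelow : (x₀, ℓ) ∉ above N h := not_lt.2 hℓ2
    rw [exitIn_of_notMem _ hx₀, if_neg hbelow]
    rfl

/-- The probability that a particle settles in `B`. -/
noncomputable def settleIn (A B : Set (Site N)) : ℝ≥0∞ := ∑' z : B, settleProb A z

theorem settleIn_eq (A B : Set (Site N)) :
    settleIn A B = (∑ x : ZMod N, exitIn A B (x, 0)) / N := by
  simp only [settleIn, settleProb, exitIn, div_eq_mul_inv, ENNReal.tsum_mul_right]
  congr 1
  exact (Summable.tsum_finsetSum fun _ _ => ENNReal.summable)

theorem settleIn_univ {A : Set (Site N)} {h : ℤ} (hA : ∀ p ∈ A, p.2 ≤ h) (hh : 0 ≤ h) :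
    settleIn A Set.univ = 1 := by
  rw [settleIn_eq, Finset.sum_congr rfl fun x _ =>
    exitIn_univ_eq_one hA (x := (x, 0)) (by simp only; omega)]
  simp only [Finset.sum_const, Finset.card_univ, ZMod.card, nsmul_eq_mul, mul_one]
  exact ENNReal.div_self (by exact_mod_cast NeZero.ne N) (by simp)

theorem settleIn_above_le (hN : 2 ≤ N) (A : Set (Site N)) {h : ℤ} (hh : 0 ≤ h) (J : ℕ)
    (hJ : J * mixDepth N ≤ (vacantLevels A 0 h).ncard) :
    settleIn A (above N h) ≤ ENNReal.ofReal ((1 - 1 / (2 * N)) ^ J) := by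
  rw [settleIn_eq]
  refine ENNReal.div_le_of_le_mul ?_
  refine (Finset.sum_le_card_nsmul _ _ (ENNReal.ofReal ((1 - 1 / (2 * N)) ^ J))
    fun x _ => ?_).trans ?_
  · rw [← ENNReal.ofReal_toReal (exitIn_ne_top A (above N h) (x, 0))]
    exact ENNReal.ofReal_le_ofReal (exitIn_above_le hN A J hh hJ)
  · simp [ZMod.card, mul_comm]

theorem settleProb_of_mem {A : Set (Site N)} {z : Site N} (hz : z ∈ A) : settleProb A z = 0 := by
  simp [settleProb, exitProb_of_mem hz]

theorem settleProb_of_lt {A : Set (Site N)} {h : ℤ} (hA : ∀ p ∈ A, p.2 ≤ h) (hh : 0 ≤ h)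
    {z : Site N} (hz : h + 1 < z.2) : settleProb A z = 0 := by
  have : ∀ n x, exitProb A n (x, 0) z = 0 := fun n x =>
    exitProb_of_lt hA hz n (by simp only; omega)
  simp [settleProb, this]

/-- A vacant vertex above an occupied vertex of level `0` is filled with probability at least
`1 / (4 N)`. -/
theorem le_settleProb {A : Set (Site N)} {x : ZMod N} (h0 : (x, 0) ∈ A) (h1 : (x, 1) ∉ A) :
    (4 * N : ℝ≥0∞)⁻¹ ≤ settleProb A (x, 1) := by
  have h2 : (4 : ℝ≥0∞)⁻¹ ≤ exitProb A 1 (x, 0) (x, 1) := by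
    rw [exitProb, if_pos h0, ← one_div]
    refine ENNReal.div_le_div_right ?_ 4
    have h4 : exitProb A 0 (x, 0 + 1) (x, 1) = 1 := by simp [exitProb, h1]
    simp only [h4]
    rw [add_assoc, add_comm, add_assoc]
    exact le_self_add
  rw [settleProb, ENNReal.mul_inv (by simp) (by simp), div_eq_mul_inv]
  refine mul_le_mul_left ?_ _
  exact h2.trans ((ENNReal.le_tsum 1).trans (Finset.single_le_sum
    (f := fun x' : ZMod N => ∑' n : ℕ, exitProb A n (x', 0) (x, 1)) (fun _ _ => zero_le)
    (Finset.mem_univ x)))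

end Walk

end IDLA

/-! ### Vacancies and one step of the chain. -/

namespace IDLA

open MeasureTheory ProbabilityTheory

namespace Cluster

variable {N : ℕ} (A : Cluster N)

theorem sites_injective : Function.Injective (Cluster.sites : Cluster N → Set (Site N)) :=
  Subtype.val_injective

theorem mem_of_nonpos {p : Site N} (hp : p.2 ≤ 0) : p ∈ A.sites := by
  obtain ⟨F, -, hA⟩ := A.2
  change p ∈ A.1
  rw [hA]
  exact Or.inl hp

theorem finite_pos : {p ∈ A.sites | 0 < p.2}.Finite := by
  obtain ⟨F, hF, hA⟩ := A.2
  refine hF.subset ?_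
  rintro p ⟨hp, hpos⟩
  change p ∈ A.1 at hp
  rw [hA] at hp
  exact hp.resolve_left (not_le.2 hpos)

theorem isGreatest_height : IsGreatest {y : ℤ | ∃ x : ZMod N, (x, y) ∈ A.sites} A.height := by
  have hb : BddAbove {y : ℤ | ∃ x : ZMod N, (x, y) ∈ A.sites} := by
    obtain ⟨M, hM⟩ := (A.finite_pos.image Prod.snd).bddAbove
    refine ⟨max M 0, ?_⟩
    rintro y ⟨x, hx⟩
    by_cases hy : 0 < y
    · exact le_max_of_le_left (hM ⟨(x, y), ⟨hx, hy⟩, rfl⟩)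
    · exact le_max_of_le_right (not_lt.1 hy)
  exact ⟨Int.csSup_mem ⟨0, 0, A.mem_of_nonpos le_rfl⟩ hb, fun y hy => le_csSup hb hy⟩

theorem le_height {p : Site N} (hp : p ∈ A.sites) : p.2 ≤ A.height :=
  A.isGreatest_height.2 ⟨p.1, hp⟩

theorem height_nonneg : 0 ≤ A.height := A.le_height (p := (0, 0)) (A.mem_of_nonpos le_rfl)

theorem height_eq {h : ℤ} (h1 : ∀ p ∈ A.sites, p.2 ≤ h) (h2 : ∃ x, (x, h) ∈ A.sites) :
    A.height = h :=
  A.isGreatest_height.unique ⟨h2, fun _ ⟨_, hx⟩ => h1 _ hx⟩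

theorem isGreatest_fill : IsGreatest {k : ℕ | rect N k ⊆ A.sites} A.fill := by
  refine ⟨A.rect_fill_subset, fun k hk => le_csSup ⟨A.height.toNat, fun j hj => ?_⟩ hk⟩
  have := A.le_height (hj (show ((0 : ZMod N), (j : ℤ)).2 ≤ j from le_rfl))
  simp only at this
  omega

/-- The vertices that a cluster leaves vacant at or below its height. -/
def vacant : Set (Site N) := {p | p ∉ A.sites ∧ p.2 ≤ A.height}

/-- The number of vacant vertices at or below the height of the cluster. -/
noncomputable def vacancies : ℕ := A.vacant.ncard

theorem vacant_pos {p : Site N} (hp : p ∈ A.vacant) : 0 < p.2 := by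
  by_contra h
  exact hp.1 (A.mem_of_nonpos (not_lt.1 h))

theorem sites_add (z : Site N) : (A.add z).sites = A.sites ∪ {z} := rfl

theorem height_add_of_le {z : Site N} (hz : z.2 ≤ A.height) : (A.add z).height = A.height := by
  refine height_eq _ ?_ ?_
  · rintro p (hp | rfl)
    · exact A.le_height hp
    · exact hz
  · obtain ⟨x, hx⟩ := A.isGreatest_height.1
    exact ⟨x, Or.inl hx⟩

theorem height_add_of_eq {z : Site N} (hz : z.2 = A.height + 1) :
    (A.add z).height = A.height + 1 := by
  refine height_eq _ ?_ ?_
  · rintro p (hp | rfl)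
    · have := A.le_height hp
      omega
    · exact hz.le
  · exact ⟨z.1, Or.inr (Prod.ext rfl hz.symm)⟩

theorem sites_shift : A.shift.sites = {p | (p.1, p.2 + (A.fill : ℤ)) ∈ A.sites} := by
  ext p
  constructor
  · rintro ⟨q, hq, rfl⟩
    simpa using hq
  · intro hp
    exact ⟨_, hp, by simp⟩

theorem height_shift : A.shift.height = A.height - A.fill := by
  refine height_eq _ ?_ ?_
  · rintro p hp
    rw [sites_shift] at hp
    have := A.le_height hp
    simp only at this
    omega
  · obtain ⟨x, hx⟩ := A.isGreatest_height.1
    refine ⟨x, ?_⟩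
    rw [sites_shift]
    simpa using hx

theorem vacancies_shift : A.shift.vacancies = A.vacancies := by
  have h : A.vacant = (fun p : Site N => (p.1, p.2 + (A.fill : ℤ))) '' A.shift.vacant := by
    ext p
    simp only [vacant, height_shift, sites_shift, Set.mem_image, Set.mem_ofPred_eq]
    constructor
    · rintro ⟨h1, h2⟩
      exact ⟨(p.1, p.2 - A.fill), ⟨by simpa using h1, by simp only; omega⟩, by simp⟩
    · rintro ⟨q, ⟨h1, h2⟩, rfl⟩
      exact ⟨h1, by simp only; omega⟩
  rw [vacancies, vacancies, h, Set.ncard_image_of_injective]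
  rintro p q hpq
  simp only [Prod.mk.injEq, add_left_inj] at hpq
  exact Prod.ext hpq.1 hpq.2

/-- Every state reached after one step is downshifted, so the finer estimates are needed only on
clusters with `fill = 0`. -/
theorem fill_shift : A.shift.fill = 0 := by
  have h1 := A.shift.isGreatest_fill.1
  have h2 : A.shift.fill + A.fill ≤ A.fill := by
    refine A.isGreatest_fill.2 fun p hp => ?_
    have hp' : p.2 ≤ ((A.shift.fill + A.fill : ℕ) : ℤ) := hp
    push_cast at hp'
    have h3 : (p.1, p.2 - (A.fill : ℤ)) ∈ A.shift.sites :=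
      h1 (show p.2 - (A.fill : ℤ) ≤ A.shift.fill by omega)
    rw [sites_shift] at h3
    simpa using h3
  omega

theorem eq_flat_of_height (h : A.height = 0) : A = flat N := by
  refine sites_injective (Set.Subset.antisymm (fun p hp => ?_) fun p hp => A.mem_of_nonpos hp)
  have h1 := A.le_height hp
  rw [h] at h1
  exact h1

theorem exists_vacant_of_ne_flat (hA : A ≠ flat N) (hfill : A.fill = 0) :
    ∃ x, (x, 1) ∈ A.vacant := by
  have hh : 1 ≤ A.height := by
    have h1 := A.height_nonneg
    have h2 : A.height ≠ 0 := fun h => hA (A.eq_flat_of_height h)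
    omega
  have h1 : ¬ rect N (1 : ℕ) ⊆ A.sites := fun h => by
    have := A.isGreatest_fill.2 h
    omega
  obtain ⟨p, hp1, hp2⟩ := Set.not_subset.1 h1
  have h3 : p.2 ≤ 1 := hp1
  have h4 : 0 < p.2 := by
    by_contra h
    exact hp2 (A.mem_of_nonpos (not_lt.1 h))
  have h5 : p = (p.1, 1) := Prod.ext rfl (by simp only; omega)
  rw [h5] at hp2
  exact ⟨p.1, hp2, hh⟩

variable [NeZero N]

theorem ncard_levels (I : Finset ℤ) : {p : Site N | p.2 ∈ I}.ncard = N * I.card := by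
  have h : {p : Site N | p.2 ∈ I} = ((Finset.univ : Finset (ZMod N)) ×ˢ I : Finset (Site N)) := by
    ext p
    simp
  rw [h, Set.ncard_coe_finset, Finset.card_product, Finset.card_univ, ZMod.card]

theorem finite_levels (I : Finset ℤ) : {p : Site N | p.2 ∈ I}.Finite :=
  (Finset.finite_toSet ((Finset.univ : Finset (ZMod N)) ×ˢ I)).subset fun p hp => by simpa using hp

theorem finite_vacant : A.vacant.Finite :=
  (finite_levels (Finset.Ioc 0 A.height)).subset fun _ hp =>
    Finset.mem_Ioc.2 ⟨A.vacant_pos hp, hp.2⟩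

theorem size_add_vacancies : (A.size : ℤ) + A.vacancies = N * A.height := by
  have h : {p ∈ A.sites | 0 < p.2} ∪ A.vacant = {p : Site N | p.2 ∈ Finset.Ioc 0 A.height} := by
    ext p
    simp only [Set.mem_union, Set.mem_ofPred_eq, Finset.mem_Ioc]
    constructor
    · rintro (⟨h1, h2⟩ | h)
      · exact ⟨h2, A.le_height h1⟩
      · exact ⟨A.vacant_pos h, h.2⟩
    · rintro ⟨h1, h2⟩
      by_cases hp : p ∈ A.sites
      · exact Or.inl ⟨hp, h1⟩
      · exact Or.inr ⟨hp, h2⟩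
  have hd : Disjoint {p ∈ A.sites | 0 < p.2} A.vacant :=
    Set.disjoint_left.2 fun p h1 h2 => h2.1 h1.1
  have h1 := Set.ncard_union_eq hd A.finite_pos A.finite_vacant
  rw [h, ncard_levels, Int.card_Ioc] at h1
  have h2 := A.height_nonneg
  have h3 : (A.size : ℤ) + A.vacancies = ((N * (A.height - 0).toNat : ℕ) : ℤ) := by
    rw [h1]
    rfl
  rw [h3]
  push_cast
  rw [sub_zero, Int.toNat_of_nonneg h2]

/-- Occupied and vacant sites together tile the `N * height` sites between level `1` and the top. -/
theorem excess_eq : A.excess = A.vacancies / N := by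
  have hN : (N : ℝ) ≠ 0 := by exact_mod_cast NeZero.ne N
  have h : (A.size : ℝ) + A.vacancies = N * A.height := by exact_mod_cast A.size_add_vacancies
  rw [excess, eq_div_iff hN, sub_mul, div_mul_cancel₀ _ hN]
  linarith

theorem vacancies_add_of_le {z : Site N} (hz : z ∈ A.vacant) :
    (A.add z).vacancies + 1 = A.vacancies := by
  have h : (A.add z).vacant = A.vacant \ {z} := by
    ext p
    simp only [vacant, A.height_add_of_le hz.2, sites_add, Set.mem_ofPred_eq, Set.mem_union,
      Set.mem_singleton_iff, Set.mem_sdiff]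
    tauto
  rw [vacancies, h, vacancies]
  exact Set.ncard_sdiff_singleton_add_one hz A.finite_vacant

theorem vacancies_add_of_eq {z : Site N} (hz : z.2 = A.height + 1) :
    (A.add z).vacancies + 1 = A.vacancies + N := by
  -- Raising the top opens a whole row of `N` sites, of which `z` alone is occupied.
  have h : insert z (A.add z).vacant = A.vacant ∪ {p | p.2 ∈ ({A.height + 1} : Finset ℤ)} := by
    ext p
    simp only [vacant, A.height_add_of_eq hz, sites_add, Set.mem_ofPred_eq, Set.mem_union,
      Set.mem_insert_iff, Set.mem_singleton_iff, Finset.mem_singleton]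
    constructor
    · rintro (rfl | ⟨h1, h2⟩)
      · exact Or.inr hz
      · rcases h2.lt_or_eq with h3 | h3
        · exact Or.inl ⟨fun h => h1 (Or.inl h), by omega⟩
        · exact Or.inr h3
    · rintro (⟨h1, h2⟩ | h)
      · by_cases hp : p = z
        · exact Or.inl hp
        · exact Or.inr ⟨by tauto, by omega⟩
      · by_cases hp : p = z
        · exact Or.inl hp
        · refine Or.inr ⟨?_, h.le⟩
          rintro (h' | h')
          · have := A.le_height h'
            omega
          · exact hp h'
  have hd : Disjoint A.vacant {p : Site N | p.2 ∈ ({A.height + 1} : Finset ℤ)} := by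
    refine Set.disjoint_left.2 fun p h1 h2 => ?_
    have h3 := h1.2
    simp only [Set.mem_ofPred_eq, Finset.mem_singleton] at h2
    omega
  have h1 := Set.ncard_union_eq hd A.finite_vacant (finite_levels _)
  rw [← h, ncard_levels, Finset.card_singleton, mul_one,
    Set.ncard_insert_of_notMem _ (A.add z).finite_vacant] at h1
  · exact h1
  · exact fun h' => h'.1 (Or.inr rfl)

/-- A cluster with many vacancies has many levels that are not full. -/
theorem vacancies_le : A.vacancies ≤ N * (vacantLevels A.sites 0 A.height).ncard := by
  have hfin := vacantLevels_finite A.sites 0 A.height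
  have h : A.vacant ⊆ {p : Site N | p.2 ∈ hfin.toFinset} := fun p hp => by
    simp only [Set.mem_ofPred_eq, Set.Finite.mem_toFinset]
    exact ⟨A.vacant_pos hp, hp.2, p.1, hp.1⟩
  have h1 := Set.ncard_le_ncard h (finite_levels _)
  rwa [ncard_levels, ← Set.ncard_eq_toFinset_card _ hfin] at h1

/-- The probability that the next particle raises the height of the cluster. -/
noncomputable def riseProb : ℝ≥0∞ := settleIn A.sites (above N A.height)

theorem settleIn_univ : settleIn A.sites Set.univ = 1 :=
  IDLA.settleIn_univ (fun _ hp => A.le_height hp) A.height_nonneg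

theorem settleIn_add_riseProb : settleIn A.sites (above N A.height)ᶜ + A.riseProb = 1 := by
  rw [← A.settleIn_univ, riseProb, add_comm]
  simp only [settleIn]
  rw [tsum_univ (fun z => settleProb A.sites z)]
  exact ENNReal.summable.tsum_add_tsum_compl ENNReal.summable

theorem riseProb_le_one : A.riseProb ≤ 1 := by
  rw [← A.settleIn_add_riseProb]
  exact le_add_self

theorem settleIn_below : settleIn A.sites (above N A.height)ᶜ = 1 - A.riseProb :=
  ENNReal.eq_sub_of_add_eq (ne_top_of_le_ne_top ENNReal.one_ne_top A.riseProb_le_one)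
    A.settleIn_add_riseProb

/-- The number of vacancies decreases by one or increases by `N - 1` in each step. -/
theorem lintegral_shiftedIDLA {F : Cluster N → ℝ≥0∞} {φ : ℕ → ℝ≥0∞}
    (hF : ∀ B : Cluster N, F B.shift = φ B.vacancies) :
    ∫⁻ B, F B ∂(shiftedIDLA N A) =
      (1 - A.riseProb) * φ (A.vacancies - 1) + A.riseProb * φ (A.vacancies + N - 1) := by
  have h1 : ∫⁻ B, F B ∂(shiftedIDLA N A) = ∑' z, settleProb A.sites z * F (A.add z).shift := by
    change ∫⁻ B, F B ∂((idlaStep A).map Cluster.shift) = _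
    rw [lintegral_map measurable_from_top measurable_from_top, idlaStep, lintegral_sum_measure]
    simp only [lintegral_smul_measure, lintegral_dirac' _
      (measurable_from_top : Measurable fun B : Cluster N => F B.shift), smul_eq_mul]
  rw [h1, ← A.settleIn_below, riseProb, settleIn, settleIn, ← ENNReal.tsum_mul_right,
    ← ENNReal.tsum_mul_right,
    ← ENNReal.summable.tsum_add_tsum_compl (s := (above N A.height)ᶜ) ENNReal.summable, compl_compl]
  congr 1
  · refine tsum_congr fun z => ?_
    -- Occupied sites carry no weight. Any other site here is a vacancy, so the truncated
    -- `A.vacancies - 1` is exact whenever it matters.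
    by_cases hz : (z : Site N) ∈ A.sites
    · simp [settleProb_of_mem hz]
    · have := A.vacancies_add_of_le (z := z) ⟨hz, not_lt.1 z.2⟩
      rw [hF]
      congr 2
      omega
  · refine tsum_congr fun z => ?_
    have hz : A.height < (z : Site N).2 := z.2
    by_cases hz' : (z : Site N).2 = A.height + 1
    · have := A.vacancies_add_of_eq (z := z) hz'
      rw [hF]
      congr 2
      omega
    · rw [settleProb_of_lt (fun _ hp => A.le_height hp) A.height_nonneg
        (by omega : A.height + 1 < (z : Site N).2)]
      simp

instance : IsMarkovKernel (shiftedIDLA N) := by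
  refine ⟨fun A => ⟨?_⟩⟩
  have h := A.lintegral_shiftedIDLA (F := fun _ => 1) (φ := fun _ => 1) fun _ => rfl
  rw [lintegral_one] at h
  rw [h, mul_one, mul_one, tsub_add_cancel_of_le A.riseProb_le_one]

theorem lintegral_shiftedIDLA_ofReal {F : Cluster N → ℝ≥0∞} {φ : ℕ → ℝ} (hφ : ∀ n, 0 ≤ φ n)
    (hF : ∀ B : Cluster N, F B.shift = ENNReal.ofReal (φ B.vacancies)) :
    ∫⁻ B, F B ∂(shiftedIDLA N A) =
      ENNReal.ofReal ((1 - A.riseProb.toReal) * φ (A.vacancies - 1) +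
        A.riseProb.toReal * φ (A.vacancies + N - 1)) := by
  have hp := A.riseProb_le_one
  have hfin := ne_top_of_le_ne_top ENNReal.one_ne_top hp
  have h1 : 0 ≤ 1 - A.riseProb.toReal := by
    rw [sub_nonneg]
    exact ENNReal.toReal_le_of_le_ofReal zero_le_one (by simpa using hp)
  rw [A.lintegral_shiftedIDLA (φ := fun n => ENNReal.ofReal (φ n)) hF,
    ENNReal.ofReal_add (mul_nonneg h1 (hφ _)) (mul_nonneg ENNReal.toReal_nonneg (hφ _)),
    ENNReal.ofReal_mul h1, ENNReal.ofReal_mul ENNReal.toReal_nonneg,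
    ENNReal.ofReal_sub _ ENNReal.toReal_nonneg, ENNReal.ofReal_toReal hfin, ENNReal.ofReal_one]

/-- From a downshifted cluster other than the flat one, a particle settles in a vacancy with
probability at least `1 / (4 N)`. -/
theorem riseProb_le_one_sub (hA : A ≠ flat N) (hfill : A.fill = 0) :
    A.riseProb.toReal ≤ 1 - 1 / (4 * N) := by
  obtain ⟨x, hx⟩ := A.exists_vacant_of_ne_flat hA hfill
  have h1 : (4 * N : ℝ≥0∞)⁻¹ ≤ 1 - A.riseProb := by
    rw [← A.settleIn_below]
    refine (le_settleProb (A.mem_of_nonpos le_rfl) hx.1).trans ?_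
    exact ENNReal.le_tsum (f := fun z : ((above N A.height)ᶜ : Set (Site N)) =>
      settleProb A.sites z) ⟨(x, 1), not_lt.2 hx.2⟩
  have h2 := ENNReal.toReal_mono (by simp) h1
  rw [ENNReal.toReal_sub_of_le A.riseProb_le_one ENNReal.one_ne_top] at h2
  simp only [ENNReal.toReal_inv, ENNReal.toReal_mul, ENNReal.toReal_ofNat, ENNReal.toReal_natCast,
    ENNReal.toReal_one] at h2
  rw [one_div]
  linarith

/-- A level holds at most `N` vacancies, so the excess is a lower bound for the number of non-full
levels. -/
theorem riseProb_le (hN : 3 ≤ N) (h : 40 * (N : ℝ) ^ 2 * Real.log N ^ 2 ≤ A.excess) :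
    A.riseProb.toReal ≤ 1 / (4 * N) := by
  have hN3 : (3 : ℝ) ≤ N := by exact_mod_cast hN
  have hN0 : (0 : ℝ) < N := by linarith
  set L := Real.log N with hL
  have hL1 : 1 ≤ L := by
    rw [hL, Real.le_log_iff_exp_le hN0]
    linarith [Real.exp_one_lt_d9]
  set I := (vacantLevels A.sites 0 A.height).ncard with hI
  have hI1 : 40 * (N : ℝ) ^ 2 * L ^ 2 ≤ I := by
    refine h.trans ?_
    rw [excess_eq, div_le_iff₀' hN0]
    exact_mod_cast A.vacancies_le
  have hNL : 1 ≤ N * L := by nlinarith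
  have hD : (mixDepth N : ℝ) ≤ 3 * (N * L) := by
    have := Nat.ceil_lt_add_one (show 0 ≤ 2 * (N : ℝ) * L by positivity)
    rw [mixDepth]
    linarith
  -- With `L = log N`, rounding up costs at most `N L` in each factor, and `13 * 3 = 39 ≤ 40`. The
  -- resulting bound `exp (-6 L)` beats `1 / (4N)`.
  have hJ : ⌈12 * (N * L)⌉₊ * mixDepth N ≤ I := by
    have h1 := Nat.ceil_lt_add_one (show 0 ≤ 12 * ((N : ℝ) * L) by positivity)
    have h2 : (⌈12 * (N * L)⌉₊ : ℝ) * mixDepth N ≤ 13 * (N * L) * (3 * (N * L)) := by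
      gcongr
      linarith
    have h3 : (⌈12 * (N * L)⌉₊ : ℝ) * mixDepth N ≤ I := by nlinarith
    exact_mod_cast h3
  refine ENNReal.toReal_le_of_le_ofReal (by positivity)
    ((settleIn_above_le (by omega) A.sites A.height_nonneg _ hJ).trans
      (ENNReal.ofReal_le_ofReal ?_))
  have h1 : (0 : ℝ) ≤ 1 - 1 / (2 * N) := by
    rw [sub_nonneg, div_le_one (by linarith)]
    linarith
  have h2 : 1 - 1 / (2 * (N : ℝ)) ≤ Real.exp (-(1 / (2 * N))) := by
    linarith [Real.add_one_le_exp (-(1 / (2 * (N : ℝ))))]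
  refine (pow_le_pow_left₀ h1 h2 _).trans ?_
  rw [← Real.exp_nat_mul, ← Real.le_log_iff_exp_le (by positivity), one_div (4 * (N : ℝ)),
    Real.log_inv, mul_neg, neg_le_neg_iff, Real.log_mul (by norm_num) hN0.ne']
  have h3 : 6 * L ≤ ⌈12 * (N * L)⌉₊ * (1 / (2 * N)) := by
    have := Nat.le_ceil (12 * (N * L))
    rw [mul_one_div, le_div_iff₀ (by positivity)]
    linarith
  have h4 : Real.log 4 ≤ 3 := by
    have := Real.log_le_sub_one_of_pos (show (0 : ℝ) < 4 by norm_num)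
    linarith
  linarith

end Cluster

end IDLA

/-! ### Drift estimates and conclusion. -/

namespace IDLA

open MeasureTheory ProbabilityTheory

/-- The Lyapunov function of the number of vacancies. Its increments are constant from `K` on and
grow geometrically towards `0`. -/
noncomputable def lyapunov (N K n : ℕ) : ℝ :=
  ∑ j ∈ Finset.range n, 2 * (4 * (N : ℝ) ^ 2) ^ (K - (j + 1))

theorem lyapunov_step {N K n : ℕ} {p : ℝ} (hN : 1 ≤ N) (hn : 1 ≤ n) (hp0 : 0 ≤ p)
    (hp1 : p ≤ 1 - 1 / (4 * N)) (hpK : K ≤ n → p ≤ 1 / (4 * N)) :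
    (1 - p) * lyapunov N K (n - 1) + p * lyapunov N K (n + N - 1) + 1 ≤ lyapunov N K n := by
  have hN1 : (1 : ℝ) ≤ N := by exact_mod_cast hN
  set b : ℝ := 4 * (N : ℝ) ^ 2 with hb
  have hb1 : 1 ≤ b := by nlinarith
  set d : ℝ := 2 * b ^ (K - (n + 1)) with hd
  have hd2 : 2 ≤ d := by
    have : 1 ≤ b ^ (K - (n + 1)) := one_le_pow₀ hb1
    linarith
  have h1 : lyapunov N K n = lyapunov N K (n - 1) + 2 * b ^ (K - n) := by
    obtain ⟨m, rfl⟩ : ∃ m, n = m + 1 := ⟨n - 1, by omega⟩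
    rw [lyapunov, Finset.sum_range_succ]
    rfl
  have h2 : lyapunov N K (n + N - 1) ≤ lyapunov N K n + (N - 1) * d := by
    rw [Nat.add_sub_assoc hN, lyapunov, lyapunov, Finset.sum_range_add]
    have h3 : ∀ i ∈ Finset.range (N - 1), 2 * b ^ (K - (n + i + 1)) ≤ d := fun i _ => by
      rw [hd]
      exact mul_le_mul_of_nonneg_left (pow_le_pow_right₀ hb1 (by omega)) zero_le_two
    have h4 := Finset.sum_le_sum h3
    rw [Finset.sum_const, Finset.card_range, nsmul_eq_mul, Nat.cast_sub hN, Nat.cast_one] at h4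
    linarith
  -- From `K` on all increments equal `2`, and `p ≤ 1 / (4N)` suffices. Below `K` the downward
  -- increment is `4 N² d`; even with probability only `1 / (4N)` it gains `N d`, which exceeds the
  -- loss `(N - 1) d` by `d ≥ 2`.
  have h5 : p * ((N - 1) * d) + 1 ≤ (1 - p) * (2 * b ^ (K - n)) := by
    by_cases hK : K ≤ n
    · have e1 : K - n = 0 := by omega
      have e2 : K - (n + 1) = 0 := by omega
      have h6 := hpK hK
      rw [le_div_iff₀ (by positivity)] at h6
      rw [hd, e1, e2]
      nlinarith
    · have e1 : K - n = (K - (n + 1)) + 1 := by omega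
      have h6 : 1 / (4 * (N : ℝ)) * (b * d) ≤ (1 - p) * (b * d) := by
        refine mul_le_mul_of_nonneg_right (by linarith) (by positivity)
      have e2 : 1 / (4 * (N : ℝ)) * (b * d) = N * d := by
        rw [hb]
        field_simp
      have e3 : 2 * b ^ (K - n) = b * d := by
        rw [e1, pow_succ, hd]
        ring
      rw [e3]
      have h7 : p * ((N - 1) * d) ≤ 1 * ((N - 1) * d) := by
        have : 0 < 1 / (4 * (N : ℝ)) := by positivity
        refine mul_le_mul_of_nonneg_right (by linarith) ?_
        exact mul_nonneg (by linarith) (by linarith)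
      linarith
  have h8 := mul_le_mul_of_nonneg_left h2 hp0
  rw [h1] at h8 ⊢
  linarith

theorem lyapunov_nonneg (N K n : ℕ) : 0 ≤ lyapunov N K n :=
  Finset.sum_nonneg fun _ _ => by positivity

theorem lyapunov_mono (N K : ℕ) : Monotone (lyapunov N K) := fun _ _ h =>
  Finset.sum_le_sum_of_subset_of_nonneg (Finset.range_mono h) fun _ _ _ => by positivity

/-- Since `N / (1 - η) ≥ N`, the parameter `η` only enlarges the threshold. -/
theorem le_excessThreshold {N : ℕ} (hN : 3 ≤ N) {η : ℝ} (hη : η ∈ Set.Ioo (0 : ℝ) 1) :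
    40 * (N : ℝ) ^ 2 * Real.log N ^ 2 ≤ excessThreshold N η := by
  have hN3 : (3 : ℝ) ≤ N := by exact_mod_cast hN
  have hN0 : (0 : ℝ) < N := by linarith
  have hL : 0 < Real.log N := Real.log_pos (by linarith)
  have h1 : Real.log N ≤ Real.log (N / (1 - η)) := by
    refine Real.log_le_log hN0 ?_
    rw [le_div_iff₀ (by linarith [hη.2])]
    nlinarith [hη.1]
  refine le_trans ?_ (Int.le_ceil _)
  rw [nStar]
  calc 40 * (N : ℝ) ^ 2 * Real.log N ^ 2
      = 2 * (20 * (N : ℝ) * Real.log N) * N * Real.log N := by ring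
    _ ≤ _ := by gcongr

variable {N : ℕ} [NeZero N]

theorem existsUnique_isStationary (hN : 3 ≤ N) :
    ∃! μ : Measure (Cluster N), IsStationary μ := by
  have hN0 : (0 : ℝ) < N := by exact_mod_cast (by omega : 0 < N)
  set K : ℕ := ⌈N * (40 * (N : ℝ) ^ 2 * Real.log N ^ 2)⌉₊ with hK
  set f := lyapunov N K with hf
  have hf0 : ∀ n, 0 ≤ f n := lyapunov_nonneg N K
  -- Clusters that are not downshifted are visited at most at time zero; their value is chosen to
  -- dominate every possible next value plus one.
  set W : Cluster N → ℝ≥0∞ := fun A =>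
    ENNReal.ofReal (if A.fill = 0 then f A.vacancies else f (A.vacancies + N) + 1) with hW
  have hint : ∀ A : Cluster N, ∫⁻ B, W B ∂(shiftedIDLA N A) =
      ENNReal.ofReal ((1 - A.riseProb.toReal) * f (A.vacancies - 1) +
        A.riseProb.toReal * f (A.vacancies + N - 1)) := fun A =>
    A.lintegral_shiftedIDLA_ofReal hf0 fun B => by
      simp only [hW, B.fill_shift, B.vacancies_shift, if_true]
  refine existsUnique_invariant (shiftedIDLA N) (flat N) (W := W) (fun _ => ENNReal.ofReal_ne_top)
    (by rw [hint]; exact ENNReal.ofReal_ne_top) fun A hA => ?_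
  have hp0 : 0 ≤ A.riseProb.toReal := ENNReal.toReal_nonneg
  have hp1 : A.riseProb.toReal ≤ 1 :=
    ENNReal.toReal_le_of_le_ofReal zero_le_one (by simpa using A.riseProb_le_one)
  have hs : 0 ≤ (1 - A.riseProb.toReal) * f (A.vacancies - 1) +
      A.riseProb.toReal * f (A.vacancies + N - 1) :=
    add_nonneg (mul_nonneg (by linarith) (hf0 _)) (mul_nonneg hp0 (hf0 _))
  rw [hint, ← ENNReal.ofReal_one, ← ENNReal.ofReal_add hs zero_le_one, hW]
  refine ENNReal.ofReal_le_ofReal ?_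
  split_ifs with hfill
  · refine lyapunov_step (by omega) ?_ hp0 (A.riseProb_le_one_sub hA hfill) fun hKn => ?_
    · obtain ⟨x, hx⟩ := A.exists_vacant_of_ne_flat hA hfill
      exact (Set.ncard_pos A.finite_vacant).2 ⟨_, hx⟩
    · refine A.riseProb_le hN ?_
      rw [A.excess_eq, le_div_iff₀' hN0]
      exact (Nat.le_ceil _).trans (Nat.cast_le.2 hKn)
  · have h1 : f (A.vacancies - 1) ≤ f (A.vacancies + N) := lyapunov_mono N K (by omega)
    have h2 : f (A.vacancies + N - 1) ≤ f (A.vacancies + N) := lyapunov_mono N K (by omega)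
    nlinarith

/-- The geometric drift of `exp 𝓔`. -/
theorem lintegral_exp_excess_le (hN : 3 ≤ N) (A : Cluster N) :
    ∫⁻ B, ENNReal.ofReal (Real.exp B.excess) ∂(shiftedIDLA N A) ≤
      ENNReal.ofReal (Real.exp (-(1 / (2 * N)))) * ENNReal.ofReal (Real.exp A.excess) +
        ENNReal.ofReal (Real.exp (40 * (N : ℝ) ^ 2 * Real.log N ^ 2 + 1)) := by
  have hN0 : (0 : ℝ) < N := by exact_mod_cast (by omega : 0 < N)
  have hlog : 0 < Real.log N := Real.log_pos (by exact_mod_cast (by omega : 1 < N))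
  rw [A.lintegral_shiftedIDLA_ofReal (φ := fun n => Real.exp (n / N))
    (fun n => (Real.exp_pos _).le) (fun B => by rw [B.shift.excess_eq, B.vacancies_shift]),
    ← ENNReal.ofReal_mul (Real.exp_pos _).le,
    ← ENNReal.ofReal_add (by positivity) (Real.exp_pos _).le]
  refine ENNReal.ofReal_le_ofReal ?_
  set p := A.riseProb.toReal
  have hp0 : 0 ≤ p := ENNReal.toReal_nonneg
  have hp1 : p ≤ 1 :=
    ENNReal.toReal_le_of_le_ofReal zero_le_one (by simpa using A.riseProb_le_one)
  by_cases h : 40 * (N : ℝ) ^ 2 * Real.log N ^ 2 ≤ A.excess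
  · refine le_add_of_le_of_nonneg ?_ (Real.exp_pos _).le
    have hp := A.riseProb_le hN h
    rw [A.excess_eq] at h ⊢
    have hn : 1 ≤ A.vacancies := by
      by_contra h0
      have h1 : A.vacancies = 0 := by omega
      rw [h1] at h
      have : 0 < 40 * (N : ℝ) ^ 2 * Real.log N ^ 2 := by positivity
      simp only [Nat.cast_zero, zero_div] at h
      linarith
    have e1 : ((A.vacancies - 1 : ℕ) : ℝ) / N = A.vacancies / N + -(1 / N) := by
      rw [Nat.cast_sub hn]
      push_cast
      ring
    have e2 : ((A.vacancies + N - 1 : ℕ) : ℝ) / N = A.vacancies / N + -(1 / N) + 1 := by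
      rw [Nat.cast_sub (by omega)]
      push_cast
      field_simp
      ring
    -- Here `p (e - 1) ≤ 2 / (4N)`. Filling a vacancy gains `exp (-1 / N)`, and the possible rise
    -- takes back only half of that exponent.
    have h2 : 1 - p + p * Real.exp 1 ≤ Real.exp (1 / (2 * N)) := by
      have h3 : p * (Real.exp 1 - 1) ≤ 1 / (4 * N) * 2 :=
        mul_le_mul hp (by linarith [Real.exp_one_lt_d9]) (by linarith [Real.add_one_le_exp 1])
          (by positivity)
      have e3 : 1 / (4 * (N : ℝ)) * 2 = 1 / (2 * N) := by
        field_simp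
        norm_num
      linarith [Real.add_one_le_exp (1 / (2 * (N : ℝ)))]
    have e4 : Real.exp (-(1 / (2 * N))) * Real.exp (A.vacancies / N) =
        Real.exp (A.vacancies / N + -(1 / N)) * Real.exp (1 / (2 * N)) := by
      rw [← Real.exp_add, ← Real.exp_add]
      congr 1
      field_simp
      ring
    rw [e1, e2, Real.exp_add _ 1, e4]
    calc _ = Real.exp (A.vacancies / N + -(1 / N)) * (1 - p + p * Real.exp 1) := by ring
      _ ≤ _ := mul_le_mul_of_nonneg_left h2 (Real.exp_pos _).le
  -- Below the threshold no contraction is needed: one step raises the excess by less than one.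
  · refine le_add_of_nonneg_of_le (by positivity) ?_
    have hb : ∀ n : ℕ, n ≤ A.vacancies + N →
        Real.exp (n / N) ≤ Real.exp (40 * (N : ℝ) ^ 2 * Real.log N ^ 2 + 1) := by
      intro n hn
      refine Real.exp_le_exp.2 ?_
      rw [A.excess_eq, not_le] at h
      have h1 : (n : ℝ) / N ≤ A.vacancies / N + 1 := by
        rw [div_add_one hN0.ne']
        gcongr
        exact_mod_cast hn
      linarith
    nlinarith [hb (A.vacancies - 1) (by omega), hb (A.vacancies + N - 1) (by omega)]

theorem IsStationary.measure_excess_le (hN : 3 ≤ N) {μ : Measure (Cluster N)}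
    (hμ : IsStationary μ) {E : ℝ} (hE : 40 * (N : ℝ) ^ 2 * Real.log N ^ 2 ≤ E) :
    μ {A | 2 * E < A.excess} ≤ ENNReal.ofReal (Real.exp (-(N : ℝ) / 2)) := by
  obtain ⟨hprob, hinv⟩ := hμ
  have hN3 : (3 : ℝ) ≤ N := by exact_mod_cast hN
  have hN0 : (0 : ℝ) < N := by linarith
  have hL : 1 ≤ Real.log N := by
    rw [Real.le_log_iff_exp_le hN0]
    linarith [Real.exp_one_lt_d9]
  set T := 40 * (N : ℝ) ^ 2 * Real.log N ^ 2
  have hT : 120 * N ≤ T := by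
    have h1 : (1 : ℝ) ≤ Real.log N ^ 2 := one_le_pow₀ hL
    have h2 : 120 * (N : ℝ) ≤ 40 * (N : ℝ) ^ 2 := by nlinarith
    exact h2.trans (le_mul_of_one_le_right (by positivity) h1)
  have hmean := lintegral_le_of_invariant hinv
    (V := fun A : Cluster N => ENNReal.ofReal (Real.exp A.excess)) measurable_from_top
    (fun _ => ENNReal.ofReal_ne_top)
    (by rw [ENNReal.ofReal_le_one, Real.exp_le_one_iff, neg_nonpos]; positivity)
    (lintegral_exp_excess_le hN)
  set c := Real.exp (-(1 / (2 * (N : ℝ))))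
  -- The contraction gap, whose inverse becomes the prefactor `4N` of the stationary mean.
  have hc : 1 / (4 * (N : ℝ)) ≤ 1 - c := by
    have h1 := Real.one_sub_inv_le_log_of_pos (show (0 : ℝ) < 1 + 1 / (2 * N) by positivity)
    have h2 : c ≤ (1 + 1 / (2 * (N : ℝ)))⁻¹ := by
      have h3 : c = (Real.exp (1 / (2 * (N : ℝ))))⁻¹ := Real.exp_neg _
      rw [h3]
      refine inv_anti₀ (by positivity) ?_
      linarith [Real.add_one_le_exp (1 / (2 * (N : ℝ)))]
    have h4 : (1 + 1 / (2 * (N : ℝ)))⁻¹ = 1 - 1 / (2 * N + 1) := by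
      field_simp
      ring
    have h5 : 1 / (4 * (N : ℝ)) ≤ 1 / (2 * N + 1) := by
      refine one_div_le_one_div_of_le (by positivity) (by linarith)
    linarith
  have hmarkov := mul_meas_ge_le_lintegral (μ := μ)
    (f := fun A : Cluster N => ENNReal.ofReal (Real.exp A.excess)) measurable_from_top
    (ENNReal.ofReal (Real.exp (2 * E)))
  have hsub : μ {A | 2 * E < A.excess} ≤
      μ {A | ENNReal.ofReal (Real.exp (2 * E)) ≤ ENNReal.ofReal (Real.exp A.excess)} :=
    measure_mono fun A hA => ENNReal.ofReal_le_ofReal (Real.exp_le_exp.2 (le_of_lt hA))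
  have hall : ENNReal.ofReal (1 / (4 * N)) * (ENNReal.ofReal (Real.exp (2 * E)) *
      μ {A | 2 * E < A.excess}) ≤ ENNReal.ofReal (Real.exp (T + 1)) := by
    refine le_trans (mul_le_mul' ?_ ((mul_le_mul_right hsub _).trans hmarkov)) hmean
    rw [← ENNReal.ofReal_one, ← ENNReal.ofReal_sub _ (Real.exp_pos _).le]
    exact ENNReal.ofReal_le_ofReal hc
  have hfin := measure_ne_top μ {A | 2 * E < A.excess}
  rw [← ENNReal.ofReal_toReal hfin, ← ENNReal.ofReal_mul (Real.exp_pos _).le,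
    ← ENNReal.ofReal_mul (by positivity), ENNReal.ofReal_le_ofReal_iff (Real.exp_pos _).le] at hall
  rw [← ENNReal.ofReal_toReal hfin]
  refine ENNReal.ofReal_le_ofReal ?_
  set m := (μ {A | 2 * E < A.excess}).toReal
  have h1 : m = 1 / (4 * N) * (Real.exp (2 * E) * m) * (4 * N) * Real.exp (-(2 * E)) := by
    rw [Real.exp_neg]
    field_simp
  rw [h1]
  have h4N : 4 * (N : ℝ) ≤ Real.exp (4 * N) := by linarith [Real.add_one_le_exp (4 * (N : ℝ))]
  calc _ ≤ Real.exp (T + 1) * Real.exp (4 * N) * Real.exp (-(2 * E)) := by gcongr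
    _ = Real.exp (T + 1 + 4 * N + -(2 * E)) := by rw [← Real.exp_add, ← Real.exp_add]
    -- As `E ≥ T ≥ 120 N`, the exponent is at most `1 + 4N - T`, well below `-N / 2`.
    _ ≤ _ := Real.exp_le_exp.2 (by linarith)

end IDLA

theorem mainTheorem9 (η : ℝ) (hη : η ∈ Set.Ioo (0 : ℝ) 1) :
    ∃ N₀ : ℕ, ∀ (N : ℕ) [NeZero N], 3 ≤ N → N₀ ≤ N →
      (∃! μ : MeasureTheory.Measure (IDLA.Cluster N), IDLA.IsStationary μ) ∧
      ∀ μ : MeasureTheory.Measure (IDLA.Cluster N), IDLA.IsStationary μ →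
        ∀ Estar : ℝ, (IDLA.excessThreshold N η : ℝ) ≤ Estar →
          μ {A : IDLA.Cluster N | 2 * Estar < A.excess} ≤
            ENNReal.ofReal (Real.exp (-(N : ℝ) / 2)) :=
  ⟨3, fun _ _ hN _ => ⟨IDLA.existsUnique_isStationary hN, fun _ hμ _ hE =>
    hμ.measure_excess_le hN ((IDLA.le_excessThreshold hN hη).trans hE)⟩⟩
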